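/- Let $k$ be a field, $f=(f_1,\dots,f_n)$ with $f_j\in k[x_1,\dots,x_n]$, and $Q=k[x_1,\dots,x_n]/(f_1,\dots,f_n)$. A prime containing all $f_j$ is an isolated zero of $f$ if it is an isolated point of $V(f_1,\dots,f_n)\subseteq\operatorname{Spec}k[x_1,\dots,x_n]$. For a linear form $\lambda$ on a $k$-algebra $A$ let $\Phi_\lambda(a,b)=\lambda(ab)$; $\lambda$ is dualizing if $\Phi_\lambda$ is non-degenerate, and bases $\{a_i\},\{b_i\}$ of $A$ are dual with respect to $\lambda$ if $\lambda(a_ib_j)=\delta_{ij}$. Let $\chi_A:A\otimes_kA\to\operatorname{Hom}_k(\operatorname{Hom}_k(A,k),A)$, $b\otimes c\mapsto[\varphi\mapsto\varphi(b)c]$. Put $$\Delta_{ij}=\frac{f_i(Y_1,\dots,Y_{j-1},X_j,\dots,X_n)-f_i(Y_1,\dots,Y_j,X_{j+1},\dots,X_n)}{X_j-Y_j}\in k[X,Y],$$ and let $\mathrm{Bez}(f)\in Q\otimes_kQ$ be the image of $\det(\Delta_{ij})$ under $X_i\mapsto x_i\otimes1$, $Y_i\mapsto1\otimes x_i$. **Global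 case.** Let $P=k[x_1,\dots,x_n]$, let $\rho:P\to Q$ be the quotient map, and assume that all zeros of $f$ are isolated. Then there are $a_{ij}\in P\otimes_kP$ with $$f_j\otimes1-1\otimes f_j=\sum_{i=1}^na_{ij}(x_i\otimes1-1\otimes x_i)\qquad(1\le j\le n),$$ and for every such choice, with $\Delta:=(\rho\otimes\rho)(\det(a_{ij}))$: 1. $\Delta=\mathrm{Bez}(f)$ in $Q\otimes_kQ$. 2. $\Theta:=\chi_Q(\Delta):\operatorname{Hom}_k(Q,k)\to Q$ is an isomorphism of $k$-vector spaces; put $\eta:=\Theta^{-1}(1)$. 3. Call $\Phi_\lambda$ a Bézoutian bilinear form if $\lambda:Q\to k$ is a dualizing linear form for which there are bases $\{a_i\},\{b_i\}$ of $Q$, dual with respect to $\lambda$, with $\mathrm{Bez}(f)=\sum_ia_i\otimes b_i$. Then $\Phi_\eta$ (the Scheja–Storch form) is a Bézoutian bilinear form, and it is the only one. Moreover, whenever $\{a_i\},\{b_i\}$ are bases of $Q$ with $\mathrm{Bez}(f)=\sum_ia_i\otimes b_i$, a linear form $\lambda$ on $Q$ makes them dual if and only if $\lambda=\eta$. **Local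 case.** Let $\mathfrak m$ be a maximal ideal of $k[x_1,\dots,x_n]$ that is an isolated zero of $f$ (the other zeros need not be isolated). Then the same assertions hold with $P$ replaced by $k[x_1,\dots,x_n]_{\mathfrak m}$, $Q$ by $Q_{\mathfrak m}=k[x_1,\dots,x_n]_{\mathfrak m}/(f_1,\dots,f_n)$, $\rho$ by the quotient map $k[x_1,\dots,x_n]_{\mathfrak m}\to Q_{\mathfrak m}$, and $\mathrm{Bez}(f)$ by the image of $\det(\Delta_{ij})$ in $Q_{\mathfrak m}\otimes_kQ_{\mathfrak m}$. -/

import Mathlib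

open scoped TensorProduct

namespace BezSS

/-! ### Bilinear forms attached to linear forms on a `k`-algebra -/

section Forms

variable {k A : Type*} [Field k] [CommRing A] [Algebra k A]

/-- The bilinear form `Φ_l : A × A → k`, `(a, b) ↦ l (a * b)`. -/
noncomputable def formOf (l : Module.Dual k A) : LinearMap.BilinForm k A :=
  (LinearMap.mul k A).compr₂ l

theorem formOf_apply (l : Module.Dual k A) (a b : A) : formOf l a b = l (a * b) := rfl

/-- `l` is a dualizing linear form: `Φ_l` is non-degenerate. -/
def IsDualizing (l : Module.Dual k A) : Prop :=
  (formOf l).Nondegenerate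

/-- The bases `a` and `b` of `A` are dual with respect to `l`. -/
def AreDual (l : Module.Dual k A) {m : ℕ} (a b : Module.Basis (Fin m) k A) : Prop :=
  ∀ i j, l (a i * b j) = if i = j then 1 else 0

/-- `Φ` is a Bézoutian bilinear form for the element `B` of `A ⊗ A`: `Φ = Φ_l` for a dualizing
linear form `l` such that `B = ∑ aᵢ ⊗ bᵢ` for bases `a`, `b` which are dual with respect to `l`. -/
def IsBezoutianForm (B : A ⊗[k] A) (Φ : LinearMap.BilinForm k A) : Prop :=
  ∃ l : Module.Dual k A, IsDualizing l ∧
    (∃ (m : ℕ) (a b : Module.Basis (Fin m) k A), AreDual l a b ∧ B = ∑ i, a i ⊗ₜ[k] b i) ∧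
    Φ = formOf l

variable (k A) in
/-- The map `χ_A : A ⊗ A → Hom (Hom (A, k), A)`, `b ⊗ c ↦ (φ ↦ φ(b) c)`. -/
noncomputable def chi : A ⊗[k] A →ₗ[k] (Module.Dual k A →ₗ[k] A) :=
  TensorProduct.lift (LinearMap.smulRightₗ ∘ₗ Module.Dual.eval k A)

theorem chi_tmul (b c : A) (φ : Module.Dual k A) : chi k A (b ⊗ₜ[k] c) φ = φ b • c := rfl

end Forms

/-! ### The Scheja–Storch element -/

section SchejaStorch

variable {k P : Type*} [Field k] [CommRing P] [Algebra k P] {n : ℕ}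

/-- The quotient `P / (g₁, …, gₙ)`. -/
abbrev QuotAlg (g : Fin n → P) : Type _ := P ⧸ Ideal.span (Set.range g)

variable (k) in
/-- The matrix `(a i j)` over `P ⊗ P` satisfies
`g_j ⊗ 1 - 1 ⊗ g_j = ∑ i, a i j * (x_i ⊗ 1 - 1 ⊗ x_i)` for every `j`. -/
def IsDifferenceMatrix (x g : Fin n → P) (a : Matrix (Fin n) (Fin n) (P ⊗[k] P)) : Prop :=
  ∀ j, g j ⊗ₜ[k] 1 - 1 ⊗ₜ[k] g j = ∑ i, a i j * (x i ⊗ₜ[k] 1 - 1 ⊗ₜ[k] x i)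

/-- `(ρ ⊗ ρ) (det a)` in `Q ⊗ Q`, where `Q = P / (g₁, …, gₙ)` and `ρ : P → Q` is the quotient
map. -/
noncomputable def schejaStorch (g : Fin n → P) (a : Matrix (Fin n) (Fin n) (P ⊗[k] P)) :
    QuotAlg g ⊗[k] QuotAlg g :=
  Algebra.TensorProduct.map (Ideal.Quotient.mkₐ k (Ideal.span (Set.range g)))
    (Ideal.Quotient.mkₐ k (Ideal.span (Set.range g))) a.det

end SchejaStorch

/-! ### The Bézoutian -/

section Bezoutian

variable {k : Type*} [Field k] {n : ℕ}

/-- The polynomial ring `k[X, Y]` in two sets of variables; `X_i` is `X (Sum.inl i)` and `Y_i`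
is `X (Sum.inr i)`. -/
abbrev PolyXY (k : Type*) [Field k] (n : ℕ) : Type _ := MvPolynomial (Fin n ⊕ Fin n) k

/-- The polynomial `p (Y_1, …, Y_j, X_{j+1}, …, X_n)`, in which the first `j` variables are
replaced by `Y`. -/
noncomputable def mixed (j : ℕ) (p : MvPolynomial (Fin n) k) : PolyXY k n :=
  MvPolynomial.aeval
    (fun l : Fin n => if (l : ℕ) < j then MvPolynomial.X (Sum.inr l) else MvPolynomial.X (Sum.inl l))
    p

/-- The divided differences are polynomials: `X_j - Y_j` divides
`p (Y_1, …, Y_{j-1}, X_j, …, X_n) - p (Y_1, …, Y_j, X_{j+1}, …, X_n)`. (Here `j : Fin n` is counted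
from `0`, so that `j` variables come before the `j`-th one.) -/
theorem X_sub_Y_dvd (p : MvPolynomial (Fin n) k) (j : Fin n) :
    (MvPolynomial.X (Sum.inl j) - MvPolynomial.X (Sum.inr j) : PolyXY k n) ∣
      mixed j p - mixed (j + 1) p := by
  rw [← Ideal.mem_span_singleton, ← Ideal.Quotient.eq]
  set I : Ideal (PolyXY k n) := Ideal.span {MvPolynomial.X (Sum.inl j) - MvPolynomial.X (Sum.inr j)}
  have h : ∀ m : ℕ, Ideal.Quotient.mk I (mixed m p) = MvPolynomial.aeval (fun l : Fin n =>
      Ideal.Quotient.mk I (if (l : ℕ) < m then MvPolynomial.X (Sum.inr l)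
        else MvPolynomial.X (Sum.inl l))) p := fun m =>
    DFunLike.congr_fun (MvPolynomial.comp_aeval (R := k) _ (Ideal.Quotient.mkₐ k I)) p
  rw [h, h]
  congr 2
  funext l
  rcases lt_trichotomy (l : ℕ) j with hl | hl | hl
  · rw [if_pos hl, if_pos (by omega)]
  · obtain rfl : l = j := Fin.ext hl
    rw [if_neg (lt_irrefl _), if_pos (by omega), Ideal.Quotient.eq]
    exact Ideal.mem_span_singleton_self _
  · rw [if_neg (by omega), if_neg (by omega)]

/-- The divided difference
`(p (Y_1, …, Y_{j-1}, X_j, …, X_n) - p (Y_1, …, Y_j, X_{j+1}, …, X_n)) / (X_j - Y_j)`,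
i.e. the unique polynomial whose product with `X_j - Y_j` is the numerator. -/
noncomputable def dividedDifference (p : MvPolynomial (Fin n) k) (j : Fin n) : PolyXY k n :=
  (X_sub_Y_dvd p j).choose

theorem dividedDifference_spec (p : MvPolynomial (Fin n) k) (j : Fin n) :
    (MvPolynomial.X (Sum.inl j) - MvPolynomial.X (Sum.inr j)) * dividedDifference p j =
      mixed j p - mixed (j + 1) p :=
  (X_sub_Y_dvd p j).choose_spec.symm

/-- The determinant `det (Δ_ij)` in `k[X, Y]`, with `Δ_ij` the `j`-th divided difference of
`f_i`. -/
noncomputable def bezPoly (f : Fin n → MvPolynomial (Fin n) k) : PolyXY k n :=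
  (Matrix.of fun i j => dividedDifference (f i) j).det

/-- The image of `det (Δ_ij)` in `A ⊗ A` under `X_i ↦ x_i ⊗ 1`, `Y_i ↦ 1 ⊗ x_i`, for a `k`-algebra
`A` with elements `x_1, …, x_n`. -/
noncomputable def bez {A : Type*} [CommRing A] [Algebra k A] (f : Fin n → MvPolynomial (Fin n) k)
    (x : Fin n → A) : A ⊗[k] A :=
  MvPolynomial.aeval (Sum.elim (fun i => x i ⊗ₜ[k] (1 : A)) (fun i => (1 : A) ⊗ₜ[k] x i))
    (bezPoly f)

/-! ### Isolated zeros, global and local algebra -/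

/-- The point `p` of affine space is an isolated zero of `f`, i.e. an isolated point of
the zero locus of `f`. -/
def IsIsolatedZero (f : Fin n → MvPolynomial (Fin n) k)
    (p : PrimeSpectrum (MvPolynomial (Fin n) k)) : Prop :=
  ∃ U : Set (PrimeSpectrum (MvPolynomial (Fin n) k)), IsOpen U ∧
    U ∩ PrimeSpectrum.zeroLocus (Set.range f) = {p}

/-- `f` has isolated zeros: every point of its zero locus is isolated. -/
def HasIsolatedZeros (f : Fin n → MvPolynomial (Fin n) k) : Prop :=
  ∀ p ∈ PrimeSpectrum.zeroLocus (Set.range f), IsIsolatedZero f p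

/-- The sequence `f_1, …, f_n` in the localization `k[x_1, …, x_n]_𝔪`. -/
noncomputable def atPrime (m : Ideal (MvPolynomial (Fin n) k)) [m.IsPrime]
    (f : Fin n → MvPolynomial (Fin n) k) : Fin n → Localization.AtPrime m :=
  fun i => algebraMap (MvPolynomial (Fin n) k) (Localization.AtPrime m) (f i)

/-- The global algebra `Q = k[x_1, …, x_n] / (f_1, …, f_n)`. -/
abbrev GlobalAlg (f : Fin n → MvPolynomial (Fin n) k) : Type _ := QuotAlg f

/-- The local algebra `Q_𝔪 = k[x_1, …, x_n]_𝔪 / (f_1, …, f_n)`. -/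
abbrev LocalAlg (f : Fin n → MvPolynomial (Fin n) k) (m : Ideal (MvPolynomial (Fin n) k))
    [m.IsPrime] : Type _ := QuotAlg (atPrime m f)

/-- The classes `x_i` in the global algebra. -/
noncomputable def xGlobal (f : Fin n → MvPolynomial (Fin n) k) (i : Fin n) : GlobalAlg f :=
  Ideal.Quotient.mk _ (MvPolynomial.X i)

/-- The classes `x_i` in the local algebra. -/
noncomputable def xLocal (f : Fin n → MvPolynomial (Fin n) k)
    (m : Ideal (MvPolynomial (Fin n) k)) [m.IsPrime] (i : Fin n) : LocalAlg f m :=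
  Ideal.Quotient.mk _ (atPrime m MvPolynomial.X i)

end Bezoutian

end BezSS

/-! Both cases concern a localization `L` of the polynomial ring, the images `g` of the `f j` in
`L`, and `Q = L / (g)`, which is finite over `k` because the zeros in question are isolated.

The class of `det a` does not depend on `a`: the differences `x i ⊗ 1 - 1 ⊗ x i` have only Koszul
relations in `L ⊗ L` (`isKoszulExact_diff`), and changing a column by a Koszul relation preserves
the determinant modulo the `g j ⊗ 1` and `1 ⊗ g j` (`det_eq_of_koszul`). The divided differences
form one admissible matrix, by telescoping, so the common class is the Bézoutian.

By Cramer's rule `q ⊗ 1 - 1 ⊗ q` kills this class `Δ`, so `Θ = chi Δ` is `Q`-linear. Dimensions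
agree, hence `Θ` is bijective as soon as its image contains a unit. The statements on dual bases are
then linear algebra: if `Δ = ∑ b i ⊗ c i`, then `Θ` sends the `j`-th coordinate form of `b` to `c
j`, and also `η (c j * ·)` to `c j`.

The unit comes from comparison with a separated system (`exists_isUnit_contract`). Choose monic `p
i` with `p i (x i) = 0` in `Q` and put `h i = p i (x i) = ∑ c i j * g j`. In `L / (h) ⊗ L / (g)` the
determinant for `h` is `det c ⊗ 1` times the one for `g`. For `h` the matrix may be taken diagonal,
and the product of the one-variable top-coefficient functionals contracts its determinant to `1`.
After localization this becomes a denominator, which is a unit in `Q`. No regular sequence argument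
for `f` is needed. -/

namespace BezSS

/-! ### Difference matrices and their determinants -/

section Koszul

variable {R S : Type*} [CommRing R] [CommRing S] {n : ℕ}

/-- Every relation among the `g i` is a consequence of the trivial relations
`g j * g i - g i * g j = 0`. -/
def IsKoszulExact (g : Fin n → R) : Prop :=
  ∀ c : Fin n → R, ∑ i, c i * g i = 0 →
    ∃ D : Matrix (Fin n) (Fin n) R, ∀ i, c i = ∑ j, (D i j - D j i) * g j

/-- Both sides compute the determinant of `B` with column `j` replaced by `e_q` and row `p` by the
`u`-combination of all rows. That combination is `u q` times `e_j`, since `u` kills the other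
columns. -/
theorem mul_det_updateCol_single (u : Fin n → R) (B : Matrix (Fin n) (Fin n) R) (j : Fin n)
    (hB : ∀ l, l ≠ j → ∑ i, u i * B i l = 0) (p q : Fin n) :
    u p * (B.updateCol j (Pi.single q 1)).det = u q * (B.updateCol j (Pi.single p 1)).det := by
  set N := B.updateCol j (Pi.single q 1) with hN
  have h1 : ∑ i, u i • N i = u q • (Pi.single j 1 : Fin n → R) := by
    ext l
    by_cases hl : l = j
    · subst hl
      simp [hN, Pi.single_apply]
    · simp [hN, hl, hB l hl]
  have h2 := Matrix.det_updateRow_sum N p u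
  rw [h1, Matrix.det_updateRow_smul, ← Matrix.adjugate_apply] at h2
  have h3 : N.adjugate j p = (B.updateCol j (Pi.single p 1)).det := by
    have h4 := congrFun (Matrix.cramer_eq_adjugate_mulVec N (Pi.single p 1)) j
    rw [Matrix.cramer_apply, hN, Matrix.updateCol_idem] at h4
    rw [h4, ← hN]
    simp
  rw [h3] at h2
  simpa using h2.symm

/-- Expansion along column `j` pairs the antisymmetric `D i l - D l i` with `u l` times a cofactor,
which is symmetric in `i` and `l` by `mul_det_updateCol_single`. -/
theorem det_updateCol_koszul (u : Fin n → R) (B D : Matrix (Fin n) (Fin n) R) (j : Fin n)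
    (hB : ∀ l, l ≠ j → ∑ i, u i * B i l = 0) :
    (B.updateCol j fun i => ∑ l, (D i l - D l i) * u l).det = 0 := by
  have h : ∀ w : Fin n → R, (B.updateCol j w).det =
      ∑ i, w i * (B.updateCol j (Pi.single i 1)).det := by
    intro w
    rw [← Matrix.cramer_apply, Matrix.cramer_eq_adjugate_mulVec, Matrix.mulVec, dotProduct]
    refine Finset.sum_congr rfl fun i _ => ?_
    rw [← Matrix.cramer_apply, Matrix.cramer_eq_adjugate_mulVec]
    simp [mul_comm]
  rw [h]
  simp only [Finset.sum_mul, sub_mul, Finset.sum_sub_distrib]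
  rw [sub_eq_zero]
  conv_rhs => rw [Finset.sum_comm]
  refine Finset.sum_congr rfl fun i _ => Finset.sum_congr rfl fun l _ => ?_
  rw [mul_assoc, mul_assoc, mul_det_updateCol_single u B j hB l i]

/-- The columns are exchanged one at a time; at every stage `u` still kills all columns, so each
exchange adds a determinant that vanishes by `det_updateCol_koszul`. -/
theorem det_eq_of_koszul (u : Fin n → R) (A A' : Matrix (Fin n) (Fin n) R)
    (hA : ∀ l, ∑ i, u i * A i l = 0) (hA' : ∀ l, ∑ i, u i * A' i l = 0)
    (h : ∀ l, ∃ D : Matrix (Fin n) (Fin n) R, ∀ i, A' i l - A i l = ∑ j, (D i j - D j i) * u j) :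
    A.det = A'.det := by
  classical
  have key : ∀ s : Finset (Fin n),
      (Matrix.of fun i l => if l ∈ s then A' i l else A i l).det = A.det := by
    intro s
    induction s using Finset.induction_on with
    | empty => exact congrArg Matrix.det (by ext i l; simp)
    | insert j s hj ih =>
      set B : Matrix (Fin n) (Fin n) R := Matrix.of fun i l => if l ∈ s then A' i l else A i l
      have hB : ∀ l, ∑ i, u i * B i l = 0 := by
        intro l
        by_cases hl : l ∈ s <;> simp [B, hl, hA, hA']
      obtain ⟨D, hD⟩ := h j
      have e : (Matrix.of fun i l => if l ∈ insert j s then A' i l else A i l) =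
          B.updateCol j ((fun i => A i j) + fun i => ∑ l, (D i l - D l i) * u l) := by
        ext i l
        by_cases hl : l = j
        · subst hl
          simp [← hD]
        · simp [hl, B]
      have e' : B.updateCol j (fun i => A i j) = B := by
        ext i l
        by_cases hl : l = j
        · subst hl
          simp [B, hj]
        · simp [hl]
      rw [e, Matrix.det_updateCol_add, det_updateCol_koszul u B D j fun l _ => hB l, e', ih,
        add_zero]
  rw [← key Finset.univ]
  congr 1
  ext i l
  simp

/-- Two matrices expressing the same elements in terms of a Koszul exact sequence have the same
determinant modulo these elements. -/
theorem IsKoszulExact.map_det_eq {g : Fin n → R} (hg : IsKoszulExact g) (φ : R →+* S)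
    (a a' : Matrix (Fin n) (Fin n) R) (h : ∀ j, ∑ i, a i j * g i = ∑ i, a' i j * g i)
    (h0 : ∀ j, φ (∑ i, a i j * g i) = 0) : φ a.det = φ a'.det := by
  rw [RingHom.map_det, RingHom.map_det]
  refine det_eq_of_koszul (fun i => φ (g i)) _ _ (fun l => ?_) (fun l => ?_) fun l => ?_
  · simpa [mul_comm] using h0 l
  · have := h0 l
    rw [h] at this
    simpa [mul_comm] using this
  · obtain ⟨D, hD⟩ := hg (fun i => a' i l - a i l) (by
      simp only [sub_mul, Finset.sum_sub_distrib, h, sub_self])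
    exact ⟨D.map φ, fun i => by simpa using congrArg φ (hD i)⟩

theorem IsKoszulExact.of_ringEquiv (e : R ≃+* S) {g : Fin n → R}
    (hg : IsKoszulExact fun i => e (g i)) : IsKoszulExact g := by
  intro c hc
  obtain ⟨D, hD⟩ := hg (fun i => e (c i)) (by simpa using congrArg e hc)
  exact ⟨D.map e.symm, fun i => e.injective (by simpa using hD i)⟩

theorem IsKoszulExact.neg {g : Fin n → R} (hg : IsKoszulExact g) :
    IsKoszulExact fun i => -g i := by
  intro c hc
  obtain ⟨D, hD⟩ := hg c (by simpa using hc)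
  refine ⟨-D, fun i => (hD i).trans (Finset.sum_congr rfl fun j _ => ?_)⟩
  simp only [Matrix.neg_apply]
  ring

/-- A common unit clears the denominators of a relation, injectivity makes it a relation over `R`,
and the solution there is divided by the unit. -/
theorem IsKoszulExact.of_localization {φ : R →+* S} (hφ : Function.Injective φ) {g : Fin n → R}
    (hg : IsKoszulExact g)
    (hφ' : ∀ c : Fin n → S, ∃ u : S, IsUnit u ∧ ∀ i, ∃ r, φ r = u * c i) :
    IsKoszulExact fun i => φ (g i) := by
  intro c hc
  obtain ⟨u, hu, hr⟩ := hφ' c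
  choose r hr using hr
  obtain ⟨D, hD⟩ := hg r (hφ (by
    simp only [map_sum, map_mul, hr, mul_assoc, ← Finset.mul_sum, hc, mul_zero, map_zero]))
  obtain ⟨v, hv⟩ := hu.exists_left_inv
  refine ⟨v • D.map φ, fun i => ?_⟩
  have h := congrArg (fun t => v * φ t) (hD i)
  simp only [hr, ← mul_assoc, hv, one_mul] at h
  rw [h, map_sum, Finset.mul_sum]
  refine Finset.sum_congr rfl fun j _ => ?_
  simp only [map_mul, map_sub, Matrix.smul_apply, Matrix.map_apply, smul_eq_mul]
  ring

theorem mem_span_X_of_mul_X_mem {A : Type*} [CommRing A] {σ : Type*} {s : Set σ} {j : σ}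
    (hj : j ∉ s) {c : MvPolynomial σ A}
    (h : c * MvPolynomial.X j ∈ Ideal.span (MvPolynomial.X '' s : Set (MvPolynomial σ A))) :
    c ∈ Ideal.span (MvPolynomial.X '' s : Set (MvPolynomial σ A)) := by
  classical
  rw [MvPolynomial.mem_ideal_span_X_image] at h ⊢
  intro m hm
  obtain ⟨i, hi, hmi⟩ := h (m + Finsupp.single j 1) (by
    rw [MvPolynomial.mem_support_iff, MvPolynomial.coeff_mul_X]
    exact MvPolynomial.mem_support_iff.mp hm)
  refine ⟨i, hi, ?_⟩
  have hij : j ≠ i := fun e => hj (e ▸ hi)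
  simpa [Finsupp.single_apply, hij] using hmi

/-- Induction on a set containing the indices of the nonzero coefficients: the last coefficient lies
in the ideal of the other variables, so Koszul relations remove it. -/
theorem isKoszulExact_X (A : Type*) [CommRing A] (n : ℕ) :
    IsKoszulExact (MvPolynomial.X : Fin n → MvPolynomial (Fin n) A) := by
  classical
  have key : ∀ (s : Finset (Fin n)) (c : Fin n → MvPolynomial (Fin n) A), (∀ i ∉ s, c i = 0) →
      ∑ i, c i * MvPolynomial.X i = 0 → ∃ D : Matrix (Fin n) (Fin n) (MvPolynomial (Fin n) A),
        ∀ i, c i = ∑ j, (D i j - D j i) * MvPolynomial.X j := by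
    intro s
    induction s using Finset.induction_on with
    | empty => exact fun c hc _ => ⟨0, fun i => by simpa using hc i⟩
    | insert j s hj ih =>
      intro c hc h0
      have h1 : c j * MvPolynomial.X j = -∑ i ∈ s, c i * MvPolynomial.X i := by
        rw [eq_neg_iff_add_eq_zero, ← Finset.sum_insert (f := fun i => c i * MvPolynomial.X i) hj,
          ← h0]
        exact Finset.sum_subset (Finset.subset_univ _) fun i _ hi => by simp [hc i hi]
      have h2 : c j ∈ Ideal.span
          (MvPolynomial.X '' (s : Set (Fin n)) : Set (MvPolynomial (Fin n) A)) := by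
        refine mem_span_X_of_mul_X_mem (j := j) (by simpa using hj) ?_
        rw [h1]
        exact neg_mem (sum_mem fun i hi => Ideal.mul_mem_left _ _
          (Ideal.subset_span ⟨i, by simpa using hi, rfl⟩))
      obtain ⟨d, hd⟩ := (Submodule.mem_span_image_finset_iff_exists_fun _).mp h2
      set d' : Fin n → MvPolynomial (Fin n) A := fun i => if h : i ∈ s then d ⟨i, h⟩ else 0 with hd'
      have hd2 : c j = ∑ i, d' i * MvPolynomial.X i := by
        rw [← hd, ← Finset.sum_subset (Finset.subset_univ s) fun i _ hi => by simp [hd', hi],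
          ← Finset.sum_coe_sort s fun i => d' i * MvPolynomial.X i]
        exact Finset.sum_congr rfl fun i _ => by simp [hd']
      have hd'j : d' j = 0 := by simp [hd', hj]
      -- Subtracting the Koszul relations with coefficients `d'` cancels `c j = ∑ d' i * X i` and
      -- adds `d' i * X j` to the coefficient at each other `i`.
      obtain ⟨D, hD⟩ := ih (fun i => if i = j then 0 else c i + d' i * MvPolynomial.X j)
        (fun i hi => by
          by_cases hij : i = j
          · simp [hij]
          · simp [hij, hc i (by simp [hij, hi]), hd', hi]) (by
          have : ∀ i, (if i = j then 0 else c i + d' i * MvPolynomial.X j) * MvPolynomial.X i =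
              c i * MvPolynomial.X i + d' i * MvPolynomial.X i * MvPolynomial.X j -
                if i = j then c j * MvPolynomial.X j else 0 := by
            intro i
            by_cases hij : i = j
            · subst hij; simp [hd'j]
            · simp [hij]; ring
          simp only [this, Finset.sum_sub_distrib, Finset.sum_add_distrib, h0, ← Finset.sum_mul,
            ← hd2]
          simp)
      refine ⟨D + Matrix.of fun i l => if i = j then d' l else 0, fun i => ?_⟩
      have e : ∀ l, ((D + Matrix.of fun i l => if i = j then d' l else 0) i l -
          (D + Matrix.of fun i l => if i = j then d' l else 0) l i) * MvPolynomial.X l =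
          (D i l - D l i) * MvPolynomial.X l + ((if i = j then d' l * MvPolynomial.X l else 0) -
            if l = j then d' i * MvPolynomial.X j else 0) := by
        intro l
        simp only [Matrix.add_apply, Matrix.of_apply]
        split_ifs with ha hb hb
        · subst hb; ring
        · ring
        · subst hb; ring
        · ring
      simp only [e, Finset.sum_add_distrib, ← hD, Finset.sum_sub_distrib]
      by_cases hij : i = j
      · subst hij
        simp [hd2, hd'j]
      · simp [hij]
  exact fun c hc => key Finset.univ c (by simp) hc

end Koszul

/-! ### Koszul exactness and generation for the differences `x i ⊗ 1 - 1 ⊗ x i` -/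

section Diff

variable {k : Type*} [Field k] {n : ℕ}

theorem exists_shift {A : Type*} [CommRing A] (a : Fin n → A) :
    ∃ e : MvPolynomial (Fin n) A ≃ₐ[A] MvPolynomial (Fin n) A,
      ∀ i, e (MvPolynomial.X i) = MvPolynomial.X i + MvPolynomial.C (a i) := by
  let sh : (Fin n → A) → MvPolynomial (Fin n) A →ₐ[A] MvPolynomial (Fin n) A := fun a =>
    MvPolynomial.aeval fun i => MvPolynomial.X i + MvPolynomial.C (a i)
  have hsh : ∀ a, (sh a).comp (sh (-a)) = AlgHom.id A _ := by
    intro a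
    ext i : 1
    simp [sh]
  exact ⟨AlgEquiv.ofAlgHom (sh a) (sh (-a)) (hsh a) (by simpa using hsh (-a)),
    fun i => by simp [sh]⟩

theorem isKoszulExact_X_sub_C {A : Type*} [CommRing A] (a : Fin n → A) :
    IsKoszulExact fun i : Fin n => (MvPolynomial.C (a i) - MvPolynomial.X i) := by
  obtain ⟨e, he⟩ := exists_shift a
  refine IsKoszulExact.of_ringEquiv e.toRingEquiv ?_
  convert (isKoszulExact_X A n).neg using 2 with i
  change e _ = _
  rw [map_sub, he, ← MvPolynomial.algebraMap_eq, e.commutes]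
  ring

/-- With the left factor as ring of coefficients, `P ⊗ P` is a polynomial ring over `P` and the
differences are constants minus variables, so a translation reduces to the variables themselves. -/
theorem isKoszulExact_diff_mvPolynomial :
    IsKoszulExact fun i : Fin n => (MvPolynomial.X i ⊗ₜ[k] 1 - 1 ⊗ₜ[k] MvPolynomial.X i :
      MvPolynomial (Fin n) k ⊗[k] MvPolynomial (Fin n) k) := by
  refine IsKoszulExact.of_ringEquiv
    (MvPolynomial.algebraTensorAlgEquiv (σ := Fin n) k (MvPolynomial (Fin n) k)).toRingEquiv ?_
  convert isKoszulExact_X_sub_C (A := MvPolynomial (Fin n) k) MvPolynomial.X using 2 with i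
  change MvPolynomial.algebraTensorAlgEquiv k (MvPolynomial (Fin n) k) _ = _
  rw [map_sub, MvPolynomial.algebraTensorAlgEquiv_tmul, MvPolynomial.algebraTensorAlgEquiv_tmul,
    map_one, MvPolynomial.smul_eq_C_mul, mul_one, MvPolynomial.map_X, one_smul]

variable {L : Type*} [CommRing L] [Algebra k L] [Algebra (MvPolynomial (Fin n) k) L]
  [IsScalarTower k (MvPolynomial (Fin n) k) L]

/-- Every element of `L ⊗ L` has a denominator `s ⊗ s` with `s ∈ M`, and `P ⊗ P → L ⊗ L` is
injective by flatness over `k`; so exactness passes from polynomials to `L`. -/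
theorem isKoszulExact_diff (M : Submonoid (MvPolynomial (Fin n) k)) [IsLocalization M L]
    (hM : M ≤ nonZeroDivisors (MvPolynomial (Fin n) k)) (x : Fin n → L)
    (hx : ∀ i, x i = algebraMap (MvPolynomial (Fin n) k) L (MvPolynomial.X i)) :
    IsKoszulExact fun i : Fin n => (x i ⊗ₜ[k] 1 - 1 ⊗ₜ[k] x i : L ⊗[k] L) := by
  set P := MvPolynomial (Fin n) k
  let ι : P →ₐ[k] L := IsScalarTower.toAlgHom k P L
  have hι : Function.Injective ι := IsLocalization.injective L hM
  let φ : P ⊗[k] P →ₐ[k] L ⊗[k] L := Algebra.TensorProduct.map ι ι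
  have hφ : Function.Injective φ :=
    TensorProduct.map_injective_of_flat_flat ι.toLinearMap ι.toLinearMap hι hι
  have h1 : ∀ c : L ⊗[k] L, ∃ s ∈ M, ∃ r, φ r = φ (s ⊗ₜ s) * c := by
    intro c
    induction c with
    | zero => exact ⟨1, M.one_mem, 0, by simp⟩
    | tmul a b =>
      obtain ⟨⟨p, s⟩, hp⟩ := IsLocalization.surj M a
      obtain ⟨⟨q, t⟩, hq⟩ := IsLocalization.surj M b
      refine ⟨s * t, (s * t).2, (t * p) ⊗ₜ (s * q), ?_⟩
      simp only [φ, Algebra.TensorProduct.map_tmul, Algebra.TensorProduct.tmul_mul_tmul, map_mul]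
      change (algebraMap P L t * algebraMap P L p) ⊗ₜ (algebraMap P L s * algebraMap P L q) =
        (algebraMap P L s * algebraMap P L t * a) ⊗ₜ (algebraMap P L s * algebraMap P L t * b)
      rw [← hp, ← hq]
      congr 1 <;> ring
    | add c d hc hd =>
      obtain ⟨s, hs, r, hr⟩ := hc
      obtain ⟨t, ht, q, hq⟩ := hd
      refine ⟨s * t, M.mul_mem hs ht, (t ⊗ₜ t) * r + (s ⊗ₜ s) * q, ?_⟩
      rw [map_add, map_mul, map_mul, hr, hq, ← Algebra.TensorProduct.tmul_mul_tmul, map_mul]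
      ring
  have h2 : ∀ s ∈ M, IsUnit (φ (s ⊗ₜ s)) := by
    intro s hs
    obtain ⟨v, hv⟩ := (IsLocalization.map_units L (⟨s, hs⟩ : M)).exists_left_inv
    refine IsUnit.of_mul_eq_one (v ⊗ₜ v) ?_
    simp only [φ, Algebra.TensorProduct.map_tmul, Algebra.TensorProduct.tmul_mul_tmul, ι,
      IsScalarTower.coe_toAlgHom']
    rw [mul_comm, hv, Algebra.TensorProduct.one_def]
  have h3 : ∀ c : Fin n → L ⊗[k] L, ∃ u : L ⊗[k] L, IsUnit u ∧ ∀ i, ∃ r, φ r = u * c i := by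
    intro c
    choose s hs r hr using fun i => h1 (c i)
    refine ⟨∏ i, φ (s i ⊗ₜ s i), ?_, fun i => ?_⟩
    · exact IsUnit.prod_iff.mpr fun i _ => h2 _ (hs i)
    · refine ⟨(∏ l ∈ Finset.univ.erase i, (s l ⊗ₜ s l)) * r i, ?_⟩
      rw [map_mul, hr, map_prod, ← Finset.prod_erase_mul _ _ (Finset.mem_univ i), mul_assoc]
  have := IsKoszulExact.of_localization (φ := φ.toRingHom) hφ
    (isKoszulExact_diff_mvPolynomial (k := k) (n := n)) h3
  convert this using 2 with i
  simp [φ, ι, hx, P]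

/-- In `L ⊗ L` the differences of the variables generate all the differences. -/
theorem diff_mem_span (M : Submonoid (MvPolynomial (Fin n) k)) [IsLocalization M L]
    (x : Fin n → L) (hx : ∀ i, x i = algebraMap (MvPolynomial (Fin n) k) L (MvPolynomial.X i))
    (c : L) : (c ⊗ₜ[k] 1 - 1 ⊗ₜ[k] c : L ⊗[k] L) ∈
      Ideal.span (Set.range fun i => (x i ⊗ₜ[k] 1 - 1 ⊗ₜ[k] x i : L ⊗[k] L)) := by
  set P := MvPolynomial (Fin n) k
  set I := Ideal.span (Set.range fun i => (x i ⊗ₜ[k] 1 - 1 ⊗ₜ[k] x i : L ⊗[k] L))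
  have hmul : ∀ a b : L, (a * b) ⊗ₜ[k] 1 - 1 ⊗ₜ[k] (a * b) = (a ⊗ₜ[k] 1) * (b ⊗ₜ[k] 1 - 1 ⊗ₜ[k] b) +
      (1 ⊗ₜ[k] b) * (a ⊗ₜ[k] 1 - 1 ⊗ₜ[k] a) := by
    intro a b
    simp only [mul_sub, Algebra.TensorProduct.tmul_mul_tmul, mul_one, one_mul, mul_comm b a]
    ring
  have hpoly : ∀ p : P, (algebraMap P L p ⊗ₜ[k] 1 - 1 ⊗ₜ[k] algebraMap P L p : L ⊗[k] L) ∈ I := by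
    intro p
    induction p using MvPolynomial.induction_on with
    | C a =>
      have : algebraMap P L (MvPolynomial.C a) = a • (1 : L) := by
        rw [← MvPolynomial.algebraMap_eq, ← IsScalarTower.algebraMap_apply,
          Algebra.algebraMap_eq_smul_one]
      rw [this, TensorProduct.smul_tmul, sub_self]
      exact zero_mem _
    | add p q hp hq =>
      rw [map_add, TensorProduct.add_tmul, TensorProduct.tmul_add, add_sub_add_comm]
      exact add_mem hp hq
    | mul_X p i hp =>
      rw [map_mul, hmul]
      refine add_mem (Ideal.mul_mem_left _ _ (Ideal.subset_span ⟨i, ?_⟩)) (Ideal.mul_mem_left _ _ hp)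
      simp [hx, P]
  obtain ⟨⟨p, s⟩, hp⟩ := IsLocalization.surj M c
  obtain ⟨v, hv⟩ := (IsLocalization.map_units L s).exists_left_inv
  have h1 := hpoly p
  rw [← hp, hmul] at h1
  -- The product rule for `c * s = p` leaves `1 ⊗ s` times the difference of `c`, and `1 ⊗ s` is a
  -- unit.
  have h2 : (1 ⊗ₜ[k] algebraMap P L s) * (c ⊗ₜ[k] 1 - 1 ⊗ₜ[k] c : L ⊗[k] L) ∈ I :=
    (add_mem_cancel_left (Ideal.mul_mem_left _ _ (hpoly s))).mp h1
  have h3 := Ideal.mul_mem_left I (1 ⊗ₜ[k] v) h2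
  rwa [← mul_assoc, Algebra.TensorProduct.tmul_mul_tmul, one_mul, hv,
    ← Algebra.TensorProduct.one_def, one_mul] at h3

/-! ### The Bézoutian as the determinant of a difference matrix -/

/-- The matrix of divided differences, in `A ⊗ A`, for a `k`-algebra `A` with elements
`x_1, …, x_n`. -/
noncomputable def bezMatrix {A : Type*} [CommRing A] [Algebra k A]
    (f : Fin n → MvPolynomial (Fin n) k) (x : Fin n → A) : Matrix (Fin n) (Fin n) (A ⊗[k] A) :=
  Matrix.of fun i j =>
    MvPolynomial.aeval (Sum.elim (fun i => x i ⊗ₜ[k] (1 : A)) (fun i => (1 : A) ⊗ₜ[k] x i))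
      (dividedDifference (f j) i)

/-- The transpose appears because `bezPoly` indexes its rows by the polynomials, whereas a
difference matrix indexes its columns by them. -/
theorem det_bezMatrix {A : Type*} [CommRing A] [Algebra k A]
    (f : Fin n → MvPolynomial (Fin n) k) (x : Fin n → A) : (bezMatrix f x).det = bez f x := by
  rw [bez, bezPoly, AlgHom.map_det, ← Matrix.det_transpose]
  rfl

/-- The sum telescopes from `mixed 0`, all variables `X`, to `mixed n`, all variables `Y`. -/
theorem isDifferenceMatrix_bezMatrix {A : Type*} [CommRing A] [Algebra k A]
    (f : Fin n → MvPolynomial (Fin n) k) (x : Fin n → A) :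
    IsDifferenceMatrix k x (fun j => MvPolynomial.aeval x (f j)) (bezMatrix f x) := by
  intro j
  set ev : PolyXY k n →ₐ[k] A ⊗[k] A :=
    MvPolynomial.aeval (Sum.elim (fun i => x i ⊗ₜ[k] (1 : A)) (fun i => (1 : A) ⊗ₜ[k] x i)) with hev
  have h : ∀ i : Fin n, bezMatrix f x i j * (x i ⊗ₜ[k] 1 - 1 ⊗ₜ[k] x i) =
      ev (mixed i (f j)) - ev (mixed (i + 1) (f j)) := by
    intro i
    rw [← map_sub, ← dividedDifference_spec, map_mul, mul_comm]
    simp [hev, bezMatrix]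
  simp only [h]
  rw [Fin.sum_univ_eq_sum_range (fun i => ev (mixed i (f j)) - ev (mixed (i + 1) (f j))) n,
    Finset.sum_range_sub']
  congr 1
  · have : ev.comp (MvPolynomial.aeval fun l : Fin n => if (l : ℕ) < 0 then MvPolynomial.X (Sum.inr l)
        else MvPolynomial.X (Sum.inl l)) =
        Algebra.TensorProduct.includeLeft.comp (MvPolynomial.aeval x) := by
      ext l
      simp [hev]
    exact (DFunLike.congr_fun this (f j)).symm
  · have : ev.comp (MvPolynomial.aeval fun l : Fin n => if (l : ℕ) < n then MvPolynomial.X (Sum.inr l)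
        else MvPolynomial.X (Sum.inl l)) =
        Algebra.TensorProduct.includeRight.comp (MvPolynomial.aeval x) := by
      ext l
      simp [hev]
    exact (DFunLike.congr_fun this (f j)).symm

theorem bez_map {A B : Type*} [CommRing A] [Algebra k A] [CommRing B] [Algebra k B]
    (π : A →ₐ[k] B) (f : Fin n → MvPolynomial (Fin n) k) (x : Fin n → A) :
    Algebra.TensorProduct.map π π (bez f x) = bez f fun i => π (x i) := by
  rw [bez, bez, ← AlgHom.comp_apply, MvPolynomial.comp_aeval]
  congr 2
  ext (i | i) <;> simp

end Diff

/-! ### Contraction of `A ⊗ B` by a linear form on `A` -/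

section Contract

variable {k : Type*} [Field k] {A B C : Type*} [CommRing A] [Algebra k A] [CommRing B] [Algebra k B]
  [CommRing C] [Algebra k C]

variable (B) in
/-- The contraction `A ⊗ B → B`, `a ⊗ b ↦ φ(a) b`. -/
noncomputable def contract (φ : Module.Dual k A) : A ⊗[k] B →ₗ[k] B :=
  TensorProduct.lift (LinearMap.lsmul k B ∘ₗ φ)

@[simp]
theorem contract_tmul (φ : Module.Dual k A) (a : A) (b : B) :
    contract B φ (a ⊗ₜ b) = φ a • b := rfl

theorem chi_apply (D : A ⊗[k] A) (φ : Module.Dual k A) : chi k A D φ = contract A φ D := by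
  induction D with
  | zero => simp
  | tmul a b => rfl
  | add x y hx hy => simp [hx, hy]

theorem contract_tmul_one_mul (φ : Module.Dual k A) (q : A) (D : A ⊗[k] B) :
    contract B φ ((q ⊗ₜ 1) * D) = contract B (φ ∘ₗ LinearMap.mulLeft k q) D := by
  induction D with
  | zero => simp
  | tmul a b => simp [Algebra.TensorProduct.tmul_mul_tmul]
  | add x y hx hy => simp [mul_add, hx, hy]

theorem contract_one_tmul_mul (φ : Module.Dual k A) (q : B) (D : A ⊗[k] B) :
    contract B φ ((1 ⊗ₜ q) * D) = q * contract B φ D := by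
  induction D with
  | zero => simp
  | tmul a b => simp [Algebra.TensorProduct.tmul_mul_tmul]
  | add x y hx hy => simp [mul_add, hx, hy]

theorem contract_map {A' B' : Type*} [CommRing A'] [Algebra k A'] [CommRing B'] [Algebra k B']
    (φ : Module.Dual k A') (π : A →ₐ[k] A') (ρ : B →ₐ[k] B') (D : A ⊗[k] B) :
    contract B' φ (Algebra.TensorProduct.map π ρ D) =
      ρ (contract B (φ ∘ₗ π.toLinearMap) D) := by
  induction D with
  | zero => simp
  | tmul a b => simp
  | add x y hx hy => simp [hx, hy]

end Contract

/-! ### From an element of `A ⊗ A` to its dualizing form -/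

section Duality

variable {k A : Type*} [Field k] [CommRing A] [Algebra k A]

/-- `Θ` sends both `Θ.symm 1 (c j * ·)` and the `j`-th coordinate form of `b` to `c j`, so these
agree. Conversely, duality makes `l (c j * ·)` that same coordinate form, and evaluation at `1`
determines `l` on the basis `c`. -/
theorem areDual_iff_of_equiv {D : A ⊗[k] A} (Θ : Module.Dual k A ≃ₗ[k] A)
    (hΘ : ∀ φ, Θ φ = contract A φ D)
    (hmul : ∀ φ q, Θ (φ ∘ₗ LinearMap.mulLeft k q) = q * Θ φ)
    {r : ℕ} (b c : Module.Basis (Fin r) k A) (hD : D = ∑ i, b i ⊗ₜ[k] c i) (l : Module.Dual k A) :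
    AreDual l b c ↔ l = Θ.symm 1 := by
  have h1 : ∀ j, Θ.symm 1 ∘ₗ LinearMap.mulLeft k (c j) = b.coord j := by
    intro j
    apply Θ.injective
    rw [hmul, Θ.apply_symm_apply, mul_one, hΘ, hD, map_sum]
    simp [Finsupp.single_apply, ite_smul]
  constructor
  · intro h
    refine c.ext fun j => ?_
    have h2 : l ∘ₗ LinearMap.mulLeft k (c j) = Θ.symm 1 ∘ₗ LinearMap.mulLeft k (c j) := by
      rw [h1]
      refine b.ext fun i => ?_
      have := h i j
      simp only [LinearMap.comp_apply, LinearMap.mulLeft_apply, Module.Basis.coord_apply,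
        Module.Basis.repr_self, Finsupp.single_apply]
      rw [mul_comm, this]
    simpa using LinearMap.congr_fun h2 1
  · rintro rfl i j
    have := LinearMap.congr_fun (h1 j) (b i)
    simp only [LinearMap.comp_apply, LinearMap.mulLeft_apply, Module.Basis.coord_apply,
      Module.Basis.repr_self, Finsupp.single_apply] at this
    rw [mul_comm, this]

/-- The `b`-coordinates of `x` are the values `l (c j * x)`. -/
theorem AreDual.isDualizing {l : Module.Dual k A} {r : ℕ} {b c : Module.Basis (Fin r) k A}
    (h : AreDual l b c) : IsDualizing l := by
  have key : ∀ x, (∀ y, l (x * y) = 0) → x = 0 := by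
    intro x hx
    have : ∀ j, b.coord j x = 0 := by
      intro j
      have h1 : b.coord j = l ∘ₗ LinearMap.mulLeft k (c j) := by
        refine b.ext fun i => ?_
        simp only [LinearMap.comp_apply, LinearMap.mulLeft_apply, Module.Basis.coord_apply,
          Module.Basis.repr_self, Finsupp.single_apply]
        rw [mul_comm, h i j]
      rw [h1, LinearMap.comp_apply, LinearMap.mulLeft_apply, mul_comm, hx]
    exact (b.forall_coord_eq_zero_iff).mp this
  exact ⟨key, fun x hx => key x fun y => by rw [mul_comm]; exact hx y⟩

/-- An element `D` of `A ⊗ A` annihilated by the kernel of the multiplication, some contraction of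
which is a unit, comes from a unique dualizing form. -/
theorem exists_equiv_of_isUnit_contract [Module.Finite k A] (D : A ⊗[k] A)
    (hD : ∀ q : A, (q ⊗ₜ 1) * D = (1 ⊗ₜ q) * D) (φ : Module.Dual k A)
    (hφ : IsUnit (contract A φ D)) :
    ∃ Θ : Module.Dual k A ≃ₗ[k] A,
      (Θ : Module.Dual k A →ₗ[k] A) = chi k A D ∧
      (∀ Φ : LinearMap.BilinForm k A, IsBezoutianForm D Φ ↔ Φ = formOf (Θ.symm 1)) ∧
      ∀ (r : ℕ) (b c : Module.Basis (Fin r) k A), D = ∑ i, b i ⊗ₜ[k] c i →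
        ∀ l : Module.Dual k A, AreDual l b c ↔ l = Θ.symm 1 := by
  have hmul : ∀ (φ : Module.Dual k A) (q : A),
      chi k A D (φ ∘ₗ LinearMap.mulLeft k q) = q * chi k A D φ := fun φ q => by
    rw [chi_apply, chi_apply, ← contract_tmul_one_mul, hD, contract_one_tmul_mul]
  -- By `hmul` the image is an ideal, and it contains a unit.
  have hsurj : Function.Surjective (chi k A D) := by
    intro a
    obtain ⟨v, hv⟩ := hφ.exists_left_inv
    refine ⟨φ ∘ₗ LinearMap.mulLeft k (a * v), ?_⟩
    rw [hmul, chi_apply, mul_assoc, hv, mul_one]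
  have hrank : Module.finrank k (Module.Dual k A) = Module.finrank k A :=
    Subspace.dual_finrank_eq
  let Θ : Module.Dual k A ≃ₗ[k] A := LinearEquiv.ofBijective (chi k A D)
    ⟨(LinearMap.injective_iff_surjective_of_finrank_eq_finrank hrank).mpr hsurj, hsurj⟩
  have hΘ : ∀ φ, Θ φ = contract A φ D := fun φ => chi_apply D φ
  have hdual := fun {r : ℕ} (b c : Module.Basis (Fin r) k A) h l =>
    areDual_iff_of_equiv (D := D) Θ hΘ hmul b c h l
  refine ⟨Θ, rfl, fun Φ => ⟨?_, ?_⟩, fun r b c h l => hdual b c h l⟩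
  · rintro ⟨l, -, ⟨m, b, c, hbc, h⟩, rfl⟩
    rw [(hdual b c h l).mp hbc]
  · rintro rfl
    let b := Module.finBasis k A
    -- Forced choice: the second factors of `D` along `b` are its contractions with the coordinate
    -- forms of `b`.
    let c : Module.Basis (Fin (Module.finrank k A)) k A := b.dualBasis.map Θ
    have hc : D = ∑ i, b i ⊗ₜ[k] c i := by
      have h1 : ∀ E : A ⊗[k] A, E = ∑ i, b i ⊗ₜ[k] contract A (b.coord i) E := by
        intro E
        induction E with
        | zero => simp
        | tmul x y =>
          simp only [contract_tmul, TensorProduct.tmul_smul, TensorProduct.smul_tmul',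
            ← TensorProduct.sum_tmul, Module.Basis.coord_apply]
          rw [b.sum_repr]
        | add x y hx hy =>
          simp only [map_add, TensorProduct.tmul_add, Finset.sum_add_distrib, ← hx, ← hy]
      refine (h1 D).trans (Finset.sum_congr rfl fun i _ => ?_)
      simp [c, hΘ]
    have hbc := (hdual b c hc _).mpr rfl
    exact ⟨_, hbc.isDualizing, ⟨_, b, c, hbc, hc⟩, rfl⟩

end Duality

/-! ### The residue functional of a product of monic univariate polynomials -/

section Residue

open Polynomial

variable {k : Type*} [Field k]

/-- The coefficients of `(p(X) - p(Y)) / (X - Y)` as a polynomial in `X`. -/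
noncomputable def horner (p : k[X]) (a : ℕ) : k[X] :=
  ∑ m ∈ Finset.Ioc a p.natDegree, C (p.coeff m) * X ^ (m - 1 - a)

theorem horner_pred {p : k[X]} (hp : p.Monic) (hd : 0 < p.natDegree) :
    horner p (p.natDegree - 1) = 1 := by
  have : Finset.Ioc (p.natDegree - 1) p.natDegree = {p.natDegree} := by
    ext m
    simp only [Finset.mem_Ioc, Finset.mem_singleton]
    omega
  simp [horner, this, hp.coeff_natDegree]

/-- Each `x ^ m - y ^ m` is `x - y` times a geometric sum; the double sum is then regrouped by the
power of `x`. -/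
theorem sum_horner_mul {A : Type*} [CommRing A] [Algebra k A] (p : k[X]) (x y : A) :
    (∑ a ∈ Finset.range p.natDegree, x ^ a * aeval y (horner p a)) * (x - y) =
      aeval x p - aeval y p := by
  rw [aeval_eq_sum_range, aeval_eq_sum_range, ← Finset.sum_sub_distrib]
  simp only [← smul_sub, ← geom_sum₂_mul, ← smul_mul_assoc, ← Finset.sum_mul, horner, map_sum,
    Finset.mul_sum, Finset.smul_sum]
  congr 1
  rw [Finset.sum_comm' (s := Finset.range (p.natDegree + 1)) (t := fun m => Finset.range m)
    (t' := Finset.range p.natDegree) (s' := fun a => Finset.Ioc a p.natDegree) (by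
      intro m a
      simp only [Finset.mem_range, Finset.mem_Ioc]
      omega)]
  refine Finset.sum_congr rfl fun a _ => Finset.sum_congr rfl fun m _ => ?_
  simp only [Algebra.smul_def, map_mul, map_pow, aeval_C, aeval_X]
  ring

/-- The functional `k[X] → k` that takes the coefficient of degree `deg p - 1` modulo `p`. -/
noncomputable def residue (p : k[X]) : k[X] →ₗ[k] k :=
  lcoeff k (p.natDegree - 1) ∘ₗ modByMonicHom p

theorem residue_mul_self {p : k[X]} (hp : p.Monic) (q : k[X]) : residue p (q * p) = 0 := by
  simp [residue, modByMonicHom, (modByMonic_eq_zero_iff_dvd hp).mpr (dvd_mul_left p q)]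

theorem residue_X_pow {p : k[X]} (hp : p.Monic) {a : ℕ} (ha : a < p.natDegree) :
    residue p (X ^ a) = if a = p.natDegree - 1 then 1 else 0 := by
  have h : (X ^ a : k[X]) %ₘ p = X ^ a := (modByMonic_eq_self_iff hp).mpr (by
    rw [degree_X_pow, degree_eq_natDegree hp.ne_zero]
    exact_mod_cast ha)
  simp [residue, modByMonicHom, h, coeff_X_pow, eq_comm]

variable {n : ℕ}

/-- The product of the functionals `residue (p i)`, on polynomials in `n` variables. -/
noncomputable def mvResidue (p : Fin n → k[X]) : Module.Dual k (MvPolynomial (Fin n) k) :=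
  (MvPolynomial.basisMonomials (Fin n) k).constr k fun m => ∏ i, residue (p i) (X ^ m i)

theorem mvResidue_monomial (p : Fin n → k[X]) (m : Fin n →₀ ℕ) :
    mvResidue p (MvPolynomial.monomial m 1) = ∏ i, residue (p i) (X ^ m i) := by
  have := (MvPolynomial.basisMonomials (Fin n) k).constr_basis k
    (fun m => ∏ i, residue (p i) (X ^ m i)) m
  rwa [MvPolynomial.coe_basisMonomials] at this

theorem mvResidue_monomial_mul_aeval (p : Fin n → k[X]) (m : Fin n →₀ ℕ) (i : Fin n) (u : k[X]) :
    mvResidue p (MvPolynomial.monomial m 1 * aeval (MvPolynomial.X i) u) =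
      (∏ l ∈ Finset.univ.erase i, residue (p l) (X ^ m l)) * residue (p i) (X ^ m i * u) := by
  induction u using Polynomial.induction_on' with
  | add u v hu hv => simp only [map_add, mul_add, hu, hv]
  | monomial a r =>
    rw [← C_mul_X_pow_eq_monomial, ← smul_eq_C_mul, map_smul, mul_smul_comm, map_smul,
      mul_smul_comm, map_smul, smul_eq_mul, smul_eq_mul, mul_left_comm, map_pow, aeval_X]
    congr 1
    rw [MvPolynomial.X_pow_eq_monomial, MvPolynomial.monomial_mul, mul_one, mvResidue_monomial,
      ← Finset.prod_erase_mul _ _ (Finset.mem_univ i), ← pow_add]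
    congr 1
    · refine Finset.prod_congr rfl fun l hl => ?_
      simp [Finset.ne_of_mem_erase hl]
    · simp

theorem mvResidue_mul_aeval {p : Fin n → k[X]} (hp : ∀ i, (p i).Monic) (i : Fin n)
    (q : MvPolynomial (Fin n) k) : mvResidue p (q * aeval (MvPolynomial.X i) (p i)) = 0 := by
  induction q using MvPolynomial.induction_on' with
  | monomial m r =>
    have h : MvPolynomial.monomial m r = r • MvPolynomial.monomial m (1 : k) := by
      rw [MvPolynomial.smul_monomial, smul_eq_mul, mul_one]
    rw [h, smul_mul_assoc, map_smul,
      mvResidue_monomial_mul_aeval, residue_mul_self (hp i), mul_zero, smul_zero]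
  | add q q' h h' => rw [add_mul, map_add, h, h', add_zero]

/-- The Bézoutian of the sequence `p i (X i)`. -/
noncomputable def diagonalBez (p : Fin n → k[X]) :
    Matrix (Fin n) (Fin n) (MvPolynomial (Fin n) k ⊗[k] MvPolynomial (Fin n) k) :=
  Matrix.diagonal fun i => ∑ a ∈ Finset.range (p i).natDegree,
    (MvPolynomial.X i ⊗ₜ 1) ^ a * aeval (1 ⊗ₜ MvPolynomial.X i) (horner (p i) a)

theorem isDifferenceMatrix_diagonalBez (p : Fin n → k[X]) :
    IsDifferenceMatrix k MvPolynomial.X (fun i => aeval (MvPolynomial.X i) (p i))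
      (diagonalBez p) := by
  intro j
  rw [Finset.sum_eq_single j (fun i _ hij => by simp [diagonalBez, Matrix.diagonal_apply_ne _ hij])
    (by simp), diagonalBez, Matrix.diagonal_apply_eq, sum_horner_mul]
  congr 1
  · exact (aeval_algHom_apply (Algebra.TensorProduct.includeLeft :
      MvPolynomial (Fin n) k →ₐ[k] _) _ _).symm
  · exact (aeval_algHom_apply (Algebra.TensorProduct.includeRight :
      MvPolynomial (Fin n) k →ₐ[k] _) _ _).symm

/-- The contraction factors over the variables. In each factor only the term of degree `natDegree -
1` survives, and its `horner` coefficient is `1` since `p i` is monic of positive degree. -/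
theorem contract_mvResidue_det_diagonalBez {p : Fin n → k[X]} (hp : ∀ i, (p i).Monic)
    (hd : ∀ i, 0 < (p i).natDegree) :
    contract (MvPolynomial (Fin n) k) (mvResidue p) (diagonalBez p).det = 1 := by
  have h1 : ∀ α : Fin n → ℕ, ∏ i, ((MvPolynomial.X i ⊗ₜ 1) ^ α i *
      aeval (1 ⊗ₜ MvPolynomial.X i) (horner (p i) (α i)) :
        MvPolynomial (Fin n) k ⊗[k] MvPolynomial (Fin n) k) =
      (MvPolynomial.monomial (Finsupp.equivFunOnFinite.symm α) 1) ⊗ₜ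
        ∏ i, aeval (MvPolynomial.X i) (horner (p i) (α i)) := by
    intro α
    have h2 : ∀ i, (aeval (1 ⊗ₜ MvPolynomial.X i) (horner (p i) (α i)) :
        MvPolynomial (Fin n) k ⊗[k] MvPolynomial (Fin n) k) =
        Algebra.TensorProduct.includeRight (aeval (MvPolynomial.X i) (horner (p i) (α i))) :=
      fun i => aeval_algHom_apply (Algebra.TensorProduct.includeRight :
        MvPolynomial (Fin n) k →ₐ[k] MvPolynomial (Fin n) k ⊗[k] MvPolynomial (Fin n) k) _ _
    have h3 : ∀ i, ((MvPolynomial.X i ⊗ₜ 1) ^ α i :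
        MvPolynomial (Fin n) k ⊗[k] MvPolynomial (Fin n) k) =
        (Algebra.TensorProduct.includeLeft : MvPolynomial (Fin n) k →ₐ[k]
          MvPolynomial (Fin n) k ⊗[k] MvPolynomial (Fin n) k) (MvPolynomial.X i ^ α i) := fun i => by
      rw [map_pow]
      rfl
    simp only [h2, h3]
    rw [Finset.prod_mul_distrib, ← map_prod, ← map_prod,
      Algebra.TensorProduct.includeLeft_apply, Algebra.TensorProduct.includeRight_apply,
      Algebra.TensorProduct.tmul_mul_tmul, one_mul, mul_one, MvPolynomial.monomial_eq, map_one,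
      one_mul, Finsupp.prod_fintype _ _ (by simp)]
    rfl
  rw [diagonalBez, Matrix.det_diagonal, Finset.prod_univ_sum, map_sum]
  have h4 : ∀ α : Fin n → ℕ, (∏ i, residue (p i) (X ^ α i)) •
      ∏ i, aeval (MvPolynomial.X i : MvPolynomial (Fin n) k) (horner (p i) (α i)) =
      ∏ i, (residue (p i) (X ^ α i)) •
        aeval (MvPolynomial.X i : MvPolynomial (Fin n) k) (horner (p i) (α i)) :=
    fun α => (Finset.prod_smul Finset.univ (fun i => residue (p i) (X ^ α i)) fun i =>
      aeval (MvPolynomial.X i : MvPolynomial (Fin n) k) (horner (p i) (α i))).symm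
  simp only [h1, contract_tmul, mvResidue_monomial, Finsupp.coe_equivFunOnFinite_symm, h4]
  rw [← Finset.prod_univ_sum (t := fun i => Finset.range (p i).natDegree) (f := fun i a =>
    residue (p i) (X ^ a) • aeval (MvPolynomial.X i : MvPolynomial (Fin n) k) (horner (p i) a))]
  refine Finset.prod_eq_one fun i _ => ?_
  rw [Finset.sum_eq_single ((p i).natDegree - 1)]
  · rw [residue_X_pow (hp i) (by have := hd i; omega), if_pos rfl, horner_pred (hp i) (hd i)]
    simp
  · intro a ha hne
    rw [residue_X_pow (hp i) (Finset.mem_range.mp ha), if_neg hne, zero_smul]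
  · intro h
    exact absurd (Finset.mem_range.mpr (by have := hd i; omega)) h

end Residue

/-! ### Cramer's rule, extension of linear forms, common denominators, monic equations -/

section Main

variable {k : Type*} [Field k] {n : ℕ}

/-- The determinant of a difference matrix is annihilated by the differences `x i ⊗ 1 - 1 ⊗ x i`,
modulo the differences of the `g j`. -/
theorem IsDifferenceMatrix.mul_det_mem {P : Type*} [CommRing P] [Algebra k P] {x g : Fin n → P}
    {a : Matrix (Fin n) (Fin n) (P ⊗[k] P)} (ha : IsDifferenceMatrix k x g a) {t : P ⊗[k] P}
    (ht : t ∈ Ideal.span (Set.range fun i => (x i ⊗ₜ[k] 1 - 1 ⊗ₜ[k] x i : P ⊗[k] P))) :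
    t * a.det ∈ Ideal.span (Set.range fun j => (g j ⊗ₜ[k] 1 - 1 ⊗ₜ[k] g j : P ⊗[k] P)) := by
  set J := Ideal.span (Set.range fun j => (g j ⊗ₜ[k] 1 - 1 ⊗ₜ[k] g j : P ⊗[k] P))
  set u : Fin n → P ⊗[k] P := fun i => x i ⊗ₜ[k] 1 - 1 ⊗ₜ[k] x i
  have h1 : Matrix.vecMul u a = fun j => g j ⊗ₜ[k] 1 - 1 ⊗ₜ[k] g j := by
    ext j
    rw [ha j]
    simp [Matrix.vecMul, dotProduct, mul_comm, u]
  have h2 : ∀ i, u i * a.det ∈ J := by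
    intro i
    -- Cramer's rule: `u` times `a` times its adjugate is `a.det • u`, and `u` times `a` is the
    -- vector of differences of the `g j`.
    have h3 := congrFun (Matrix.vecMul_vecMul u a a.adjugate) i
    rw [Matrix.mul_adjugate, Matrix.vecMul_smul, Matrix.vecMul_one, h1] at h3
    rw [mul_comm, ← smul_eq_mul, ← Pi.smul_apply, ← h3, Matrix.vecMul, dotProduct]
    refine sum_mem fun j _ => ?_
    exact Ideal.mul_mem_right _ _ (Ideal.subset_span ⟨j, rfl⟩)
  induction ht using Submodule.span_induction with
  | mem t ht => obtain ⟨i, rfl⟩ := ht; exact h2 i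
  | zero => simp
  | add s t _ _ hs ht => rw [add_mul]; exact add_mem hs ht
  | smul r t _ ht => rw [smul_eq_mul, mul_assoc]; exact Ideal.mul_mem_left _ _ ht

/-- The part with `g j ⊗ 1` is killed by `τ`, and `1 ⊗ g j` comes out as a factor `g j`. -/
theorem contract_mem_of_mem_span {P : Type*} [CommRing P] [Algebra k P] {g : Fin n → P}
    (τ : Module.Dual k P) (hτ : ∀ i q, τ (q * g i) = 0) {t : P ⊗[k] P}
    (ht : t ∈ Ideal.span (Set.range fun j => (g j ⊗ₜ[k] 1 - 1 ⊗ₜ[k] g j : P ⊗[k] P))) :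
    contract P τ t ∈ Ideal.span (Set.range g) := by
  obtain ⟨r, rfl⟩ := (Ideal.mem_span_range_iff_exists_fun).mp ht
  rw [map_sum]
  refine sum_mem fun i _ => ?_
  rw [mul_comm, sub_mul, map_sub, contract_tmul_one_mul, contract_one_tmul_mul]
  have h0 : τ ∘ₗ LinearMap.mulLeft k (g i) = 0 := by
    ext q
    simp [mul_comm (g i), hτ]
  have h1 : contract P (0 : Module.Dual k P) (r i) = 0 := by
    induction r i with
    | zero => simp
    | tmul a b => simp
    | add x y hx hy => rw [map_add, hx, hy, add_zero]
  rw [h0, h1, zero_sub]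
  exact neg_mem (Ideal.mul_mem_right _ _ (Ideal.subset_span ⟨i, rfl⟩))

/-- A linear form on `V` that vanishes on the kernel of `j : V → W` extends along `j`. -/
theorem exists_dual_comp_eq {V W : Type*} [AddCommGroup V] [Module k V] [AddCommGroup W]
    [Module k W] (j : V →ₗ[k] W) (f : Module.Dual k V) (h : ∀ v, j v = 0 → f v = 0) :
    ∃ ψ : Module.Dual k W, ψ ∘ₗ j = f := by
  have : f ∈ LinearMap.range j.dualMap := by
    rw [LinearMap.range_dualMap_eq_dualAnnihilator_ker, Submodule.mem_dualAnnihilator]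
    exact fun v hv => h v hv
  exact this

/-- In a Noetherian ring finitely many denominators suffice for an ideal of a localization. -/
theorem exists_mul_mem_of_algebraMap_mem {R L : Type*} [CommRing R] [IsNoetherianRing R]
    [CommRing L] [Algebra R L] (M : Submonoid R) [IsLocalization M L] (I : Ideal R) :
    ∃ s ∈ M, ∀ y, algebraMap R L y ∈ I.map (algebraMap R L) → s * y ∈ I := by
  classical
  obtain ⟨T, hT⟩ := IsNoetherian.noetherian ((I.map (algebraMap R L)).comap (algebraMap R L))
  have h1 : ∀ y ∈ T, ∃ s ∈ M, s * y ∈ I := fun y hy =>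
    (IsLocalization.algebraMap_mem_map_algebraMap_iff M L I y).mp
      (by
        have : y ∈ (I.map (algebraMap R L)).comap (algebraMap R L) :=
          hT ▸ Submodule.subset_span hy
        exact this)
  choose! s hs hsI using h1
  refine ⟨∏ y ∈ T, s y, prod_mem hs, fun y hy => ?_⟩
  have h2 : y ∈ Submodule.span R (T : Set R) := by
    rw [hT]
    exact hy
  induction h2 using Submodule.span_induction with
  | mem y hyT =>
    rw [← Finset.prod_erase_mul T s hyT, mul_assoc]
    exact Ideal.mul_mem_left _ _ (hsI y hyT)
  | zero => simp
  | add y z hyT hzT h h' =>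
    rw [mul_add]
    have hc : ∀ w ∈ Submodule.span R (T : Set R), algebraMap R L w ∈ I.map (algebraMap R L) := by
      intro w hw
      rw [hT] at hw
      exact hw
    exact add_mem (h (hc y hyT)) (h' (hc z hzT))
  | smul r y hyT h =>
    have hc : algebraMap R L y ∈ I.map (algebraMap R L) := by
      rw [hT] at hyT
      exact hyT
    rw [smul_eq_mul, mul_left_comm]
    exact Ideal.mul_mem_left _ _ (h hc)

/-- In an algebra finite over a field, finitely many elements satisfy monic equations. -/
theorem exists_monic_aeval_eq_zero {A : Type*} [CommRing A] [Algebra k A] [Module.Finite k A]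
    (y : Fin n → A) : ∃ p : Fin n → Polynomial k, (∀ i, (p i).Monic) ∧
      (∀ i, 0 < (p i).natDegree) ∧ ∀ i, Polynomial.aeval (y i) (p i) = 0 := by
  have hint : ∀ i, IsIntegral k (y i) := fun i => Algebra.IsIntegral.isIntegral _
  -- The factor `X` keeps the degree positive when `A` is the zero ring, where the minimal
  -- polynomial is `1`.
  refine ⟨fun i => minpoly k (y i) * Polynomial.X,
    fun i => (minpoly.monic (hint i)).mul Polynomial.monic_X, fun i => ?_, fun i => ?_⟩
  · rw [(minpoly.monic (hint i)).natDegree_mul Polynomial.monic_X, Polynomial.natDegree_X]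
    omega
  · simp

end Main

/-! ### Comparison with a separated monic system; the theorem over a localization -/

section Local

variable {k : Type*} [Field k] {n : ℕ}

theorem mk_span_range_eq_zero {P : Type*} [CommRing P] [Algebra k P] (g : Fin n → P) (j : Fin n) :
    Ideal.Quotient.mkₐ k (Ideal.span (Set.range g)) (g j) = 0 :=
  Ideal.Quotient.eq_zero_iff_mem.mpr (Ideal.subset_span ⟨j, rfl⟩)

/-- The transition between difference matrices of two sequences, one contained in the ideal of
the other. -/
theorem IsDifferenceMatrix.exists_transition {L : Type*} [CommRing L] [Algebra k L]
    {x g h : Fin n → L}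
    (hspan : ∀ c : L, (c ⊗ₜ[k] 1 - 1 ⊗ₜ[k] c : L ⊗[k] L) ∈
      Ideal.span (Set.range fun i => (x i ⊗ₜ[k] 1 - 1 ⊗ₜ[k] x i : L ⊗[k] L)))
    {a : Matrix (Fin n) (Fin n) (L ⊗[k] L)} (ha : IsDifferenceMatrix k x g a)
    (c : Matrix (Fin n) (Fin n) L) (hc : ∀ i, h i = ∑ j, c i j * g j)
    {A B : Type*} [CommRing A] [Algebra k A] [CommRing B] [Algebra k B]
    (π : L →ₐ[k] A) (ρ : L →ₐ[k] B) (hρ : ∀ j, ρ (g j) = 0) :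
    ∃ b : Matrix (Fin n) (Fin n) (L ⊗[k] L), IsDifferenceMatrix k x h b ∧
      Algebra.TensorProduct.map π ρ b.det =
        (π c.det ⊗ₜ 1) * Algebra.TensorProduct.map π ρ a.det := by
  have h1 : ∀ i j, ∃ e : Fin n → L ⊗[k] L, ∑ l, e l * (x l ⊗ₜ[k] 1 - 1 ⊗ₜ[k] x l) =
      c i j ⊗ₜ[k] 1 - 1 ⊗ₜ[k] c i j :=
    fun i j => (Ideal.mem_span_range_iff_exists_fun).mp (hspan (c i j))
  choose e he using h1
  -- The product rule for `c i j * g j` dictates the matrix; its terms with `1 ⊗ g j` die under `ρ`,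
  -- leaving a matrix product.
  refine ⟨Matrix.of fun l i => ∑ j, ((c i j ⊗ₜ 1) * a l j + (1 ⊗ₜ g j) * e i j l),
    fun i => ?_, ?_⟩
  · have h2 : ∀ j, (c i j * g j) ⊗ₜ[k] 1 - 1 ⊗ₜ[k] (c i j * g j) =
        ∑ l, ((c i j ⊗ₜ 1) * a l j + (1 ⊗ₜ g j) * e i j l) * (x l ⊗ₜ[k] 1 - 1 ⊗ₜ[k] x l) := by
      intro j
      simp only [add_mul, Finset.sum_add_distrib, mul_assoc]
      rw [← Finset.mul_sum, ← Finset.mul_sum, ← ha j, he i j]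
      simp only [mul_sub, Algebra.TensorProduct.tmul_mul_tmul, mul_one, one_mul, mul_comm (g j)]
      ring
    rw [hc i, TensorProduct.sum_tmul, TensorProduct.tmul_sum, ← Finset.sum_sub_distrib]
    simp only [h2]
    rw [Finset.sum_comm]
    simp only [Matrix.of_apply, Finset.sum_mul]
  · have h3 : (π c.det ⊗ₜ 1 : A ⊗[k] B) =
        ((Algebra.TensorProduct.includeLeft.comp π : L →ₐ[k] A ⊗[k] B).mapMatrix c.transpose).det := by
      rw [← AlgHom.map_det, Matrix.det_transpose]
      rfl
    rw [h3, AlgHom.map_det, AlgHom.map_det, mul_comm, ← Matrix.det_mul]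
    congr 1
    ext l i
    simp only [AlgHom.mapMatrix_apply, Matrix.map_apply, Matrix.of_apply, map_sum, map_add, map_mul,
      Algebra.TensorProduct.map_tmul, hρ, map_one, TensorProduct.tmul_zero, zero_mul, add_zero,
      Matrix.mul_apply, Matrix.transpose_apply]
    exact Finset.sum_congr rfl fun j _ => mul_comm _ _

variable {L : Type*} [CommRing L] [Algebra k L] [Algebra (MvPolynomial (Fin n) k) L]
  [IsScalarTower k (MvPolynomial (Fin n) k) L]

/-- Uniqueness of the determinant of a difference matrix, modulo ideals containing the `g j`. -/
theorem IsDifferenceMatrix.map_det_eq (M : Submonoid (MvPolynomial (Fin n) k)) [IsLocalization M L]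
    (hM : M ≤ nonZeroDivisors (MvPolynomial (Fin n) k)) {x g : Fin n → L}
    (hx : ∀ i, x i = algebraMap (MvPolynomial (Fin n) k) L (MvPolynomial.X i))
    {a a' : Matrix (Fin n) (Fin n) (L ⊗[k] L)} (ha : IsDifferenceMatrix k x g a)
    (ha' : IsDifferenceMatrix k x g a') {A B : Type*} [CommRing A] [Algebra k A] [CommRing B]
    [Algebra k B] (π : L →ₐ[k] A) (ρ : L →ₐ[k] B) (hπ : ∀ j, π (g j) = 0) (hρ : ∀ j, ρ (g j) = 0) :
    Algebra.TensorProduct.map π ρ a.det = Algebra.TensorProduct.map π ρ a'.det := by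
  refine (isKoszulExact_diff M hM x hx).map_det_eq
    (Algebra.TensorProduct.map π ρ).toRingHom a a' (fun j => ?_) fun j => ?_
  · rw [← ha j, ← ha' j]
  · rw [← ha j]
    simp [hπ, hρ]

/-- `mvResidue p` itself need not factor through `L / (h)`. Multiplied by a denominator `s` that
brings the contraction of `(h)` back into the polynomial ideal `(F)`, it does, and the contraction
changes from `1` to `s` modulo `(h)`. -/
theorem exists_isUnit_contract_diagonalBez (M : Submonoid (MvPolynomial (Fin n) k))
    [IsLocalization M L] {p : Fin n → Polynomial k} (hp : ∀ i, (p i).Monic)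
    (hd : ∀ i, 0 < (p i).natDegree) (h : Fin n → L)
    (hh : ∀ i, h i = algebraMap (MvPolynomial (Fin n) k) L
      (Polynomial.aeval (MvPolynomial.X i) (p i))) :
    ∃ ψ : Module.Dual k (QuotAlg h), ∃ s ∈ M, ∃ r ∈ Ideal.span (Set.range h),
      contract L (ψ ∘ₗ (Ideal.Quotient.mkₐ k (Ideal.span (Set.range h))).toLinearMap)
        (Algebra.TensorProduct.map (IsScalarTower.toAlgHom k (MvPolynomial (Fin n) k) L)
          (IsScalarTower.toAlgHom k (MvPolynomial (Fin n) k) L) (diagonalBez p).det) =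
        algebraMap (MvPolynomial (Fin n) k) L s + r := by
  let F : Fin n → MvPolynomial (Fin n) k := fun i => Polynomial.aeval (MvPolynomial.X i) (p i)
  let ι := IsScalarTower.toAlgHom k (MvPolynomial (Fin n) k) L
  have hmap : (Ideal.span (Set.range F)).map (algebraMap (MvPolynomial (Fin n) k) L) =
      Ideal.span (Set.range h) := by
    rw [Ideal.map_span, ← Set.range_comp]
    congr 2
    ext i
    exact (hh i).symm
  obtain ⟨s, hs, hsF⟩ := exists_mul_mem_of_algebraMap_mem (L := L) M (Ideal.span (Set.range F))
  rw [hmap] at hsF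
  set τ := mvResidue p
  have hτ : ∀ i q, τ (q * F i) = 0 := fun i q => mvResidue_mul_aeval hp i q
  have hτ' : ∀ y ∈ Ideal.span (Set.range F), τ y = 0 := by
    intro y hy
    obtain ⟨r, rfl⟩ := (Ideal.mem_span_range_iff_exists_fun).mp hy
    simp [hτ]
  obtain ⟨ψ, hψ⟩ := exists_dual_comp_eq
    ((Ideal.Quotient.mkₐ k (Ideal.span (Set.range h))).comp ι).toLinearMap
    (τ ∘ₗ LinearMap.mulLeft k s) (fun v hv =>
      hτ' _ (hsF v (Ideal.Quotient.eq_zero_iff_mem.mp hv)))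
  have : IsLocalization (⊥ : Submonoid (MvPolynomial (Fin n) k)) (MvPolynomial (Fin n) k) :=
    IsLocalization.self bot_le
  have hdiff : (s ⊗ₜ[k] 1 - 1 ⊗ₜ[k] s) * (diagonalBez p).det ∈
      Ideal.span (Set.range fun j => (F j ⊗ₜ[k] 1 - 1 ⊗ₜ[k] F j)) :=
    (isDifferenceMatrix_diagonalBez p).mul_det_mem
      (diff_mem_span (⊥ : Submonoid (MvPolynomial (Fin n) k)) MvPolynomial.X (fun i => rfl) s)
  -- The error term replaces `s ⊗ 1` by `1 ⊗ s`; the determinant kills this difference modulo the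
  -- differences of the `F j`.
  refine ⟨ψ, s, hs, ι (contract (MvPolynomial (Fin n) k) τ
    ((s ⊗ₜ[k] 1 - 1 ⊗ₜ[k] s) * (diagonalBez p).det)), ?_, ?_⟩
  · rw [← hmap]
    exact Ideal.mem_map_of_mem _ (contract_mem_of_mem_span τ hτ hdiff)
  · have hψ' : (ψ ∘ₗ (Ideal.Quotient.mkₐ k (Ideal.span (Set.range h))).toLinearMap) ∘ₗ
        ι.toLinearMap = τ ∘ₗ LinearMap.mulLeft k s := hψ
    rw [contract_map, hψ', ← contract_tmul_one_mul, sub_mul, map_sub, contract_one_tmul_mul,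
      contract_mvResidue_det_diagonalBez hp hd, mul_one, map_sub]
    change ι _ = ι s + _
    ring

/-- The form is `v ↦ ψ (det c * v)`, with `ψ` taken from the separated system `h = c g`; the
transition formula turns its contraction into the one for `h`, a denominator. -/
theorem exists_isUnit_contract (M : Submonoid (MvPolynomial (Fin n) k)) [IsLocalization M L]
    (hM : M ≤ nonZeroDivisors (MvPolynomial (Fin n) k)) {x g : Fin n → L}
    (hx : ∀ i, x i = algebraMap (MvPolynomial (Fin n) k) L (MvPolynomial.X i))
    [Module.Finite k (QuotAlg g)]
    {a : Matrix (Fin n) (Fin n) (L ⊗[k] L)} (ha : IsDifferenceMatrix k x g a) :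
    ∃ φ : Module.Dual k (QuotAlg g), IsUnit (contract (QuotAlg g) φ (schejaStorch g a)) := by
  set ρ := Ideal.Quotient.mkₐ k (Ideal.span (Set.range g))
  obtain ⟨p, hp, hd, hpy⟩ := exists_monic_aeval_eq_zero (k := k) fun i => ρ (x i)
  let F : Fin n → MvPolynomial (Fin n) k := fun i => Polynomial.aeval (MvPolynomial.X i) (p i)
  let ι := IsScalarTower.toAlgHom k (MvPolynomial (Fin n) k) L
  let h : Fin n → L := fun i => ι (F i)
  have hF : ∀ i, h i = Polynomial.aeval (x i) (p i) := fun i => by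
    rw [hx]
    exact (Polynomial.aeval_algHom_apply ι _ _).symm
  have hmem : ∀ i, h i ∈ Ideal.span (Set.range g) := fun i => by
    rw [← Ideal.Quotient.eq_zero_iff_mem, hF]
    exact (Polynomial.aeval_algHom_apply ρ (x i) (p i)).symm.trans (hpy i)
  have hle : Ideal.span (Set.range h) ≤ Ideal.span (Set.range g) :=
    Ideal.span_le.mpr (by rintro _ ⟨i, rfl⟩; exact hmem i)
  choose c hc using fun i => (Ideal.mem_span_range_iff_exists_fun).mp (hmem i)
  set π := Ideal.Quotient.mkₐ k (Ideal.span (Set.range h))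
  obtain ⟨b, hb, hdet⟩ := ha.exists_transition (diff_mem_span M x hx) (Matrix.of c)
    (h := h) (fun i => (hc i).symm) π ρ (mk_span_range_eq_zero g)
  have hb' : IsDifferenceMatrix k x h ((Algebra.TensorProduct.map ι ι).mapMatrix (diagonalBez p)) := by
    intro j
    have := congrArg (Algebra.TensorProduct.map ι ι) (isDifferenceMatrix_diagonalBez p j)
    simpa [hx, ι, h, F] using this
  -- The comparison takes place in `L / (h) ⊗ L / (g)`: `ψ` lives on the first quotient, and the
  -- transition formula needs `g` to vanish in the second.
  have hbb := hb.map_det_eq M hM hx hb' π ρ (mk_span_range_eq_zero h) fun j =>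
    Ideal.Quotient.eq_zero_iff_mem.mpr (hmem j)
  obtain ⟨ψ, s, hs, r, hr, hψ⟩ := exists_isUnit_contract_diagonalBez (L := L) M hp hd h
    (fun i => rfl)
  -- Multiplying `c g = h` by the adjugate puts `det c * g j` in `(h)`, so the form `v ↦ ψ (det c *
  -- v)` descends to `L / (g)`.
  have hcg : ∀ j, π ((Matrix.of c).det * g j) = 0 := by
    intro j
    have h1 : Matrix.mulVec (Matrix.of c) g = h := by
      ext i
      exact hc i
    have h2 := congrFun (Matrix.mulVec_mulVec g (Matrix.of c).adjugate (Matrix.of c)) j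
    rw [Matrix.adjugate_mul, Matrix.smul_mulVec, Matrix.one_mulVec, h1, Pi.smul_apply,
      smul_eq_mul] at h2
    rw [← h2, Matrix.mulVec, dotProduct, map_sum]
    refine Finset.sum_eq_zero fun i _ => ?_
    rw [map_mul, mk_span_range_eq_zero h i, mul_zero]
  obtain ⟨φ, hφ⟩ := exists_dual_comp_eq ρ.toLinearMap
    (ψ ∘ₗ π.toLinearMap ∘ₗ LinearMap.mulLeft k (Matrix.of c).det) (fun v hv => by
      obtain ⟨t, rfl⟩ := (Ideal.mem_span_range_iff_exists_fun).mp
        (Ideal.Quotient.eq_zero_iff_mem.mp hv)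
      have : π ((Matrix.of c).det * ∑ i, t i * g i) = 0 := by
        rw [Finset.mul_sum, map_sum]
        refine Finset.sum_eq_zero fun i _ => ?_
        rw [mul_left_comm, map_mul, hcg, mul_zero]
      change ψ (π _) = 0
      rw [LinearMap.mulLeft_apply, this, map_zero])
  refine ⟨φ, ?_⟩
  have key : contract (QuotAlg g) φ (schejaStorch g a) = ρ (algebraMap _ L s) := by
    have hr0 : ρ r = 0 := Ideal.Quotient.eq_zero_iff_mem.mpr (hle hr)
    have e1 : (ψ ∘ₗ LinearMap.mulLeft k (π (Matrix.of c).det)) ∘ₗ π.toLinearMap =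
        ψ ∘ₗ π.toLinearMap ∘ₗ LinearMap.mulLeft k (Matrix.of c).det := by
      ext v
      simp
    rw [schejaStorch, contract_map, hφ, ← e1, ← contract_map, ← contract_tmul_one_mul, ← hdet, hbb,
      ← AlgHom.map_det, contract_map, hψ, map_add, hr0, add_zero]
  rw [key]
  exact (IsLocalization.map_units L (⟨s, hs⟩ : M)).map ρ

theorem schejaStorch_eq_bez (M : Submonoid (MvPolynomial (Fin n) k)) [IsLocalization M L]
    (hM : M ≤ nonZeroDivisors (MvPolynomial (Fin n) k)) (f : Fin n → MvPolynomial (Fin n) k)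
    {x g : Fin n → L} (hx : ∀ i, x i = algebraMap (MvPolynomial (Fin n) k) L (MvPolynomial.X i))
    (hg : ∀ i, g i = algebraMap (MvPolynomial (Fin n) k) L (f i)) :
    IsDifferenceMatrix k x g (bezMatrix f x) ∧
      ∀ a, IsDifferenceMatrix k x g a → schejaStorch g a =
        bez f fun i => Ideal.Quotient.mkₐ k (Ideal.span (Set.range g)) (x i) := by
  have hb : IsDifferenceMatrix k x g (bezMatrix f x) := by
    have h1 : g = fun j => MvPolynomial.aeval x (f j) := by
      ext j
      have : MvPolynomial.aeval x = IsScalarTower.toAlgHom k (MvPolynomial (Fin n) k) L := by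
        ext i
        simp [hx]
      rw [hg, this]
      rfl
    rw [h1]
    exact isDifferenceMatrix_bezMatrix f x
  refine ⟨hb, fun a ha => ?_⟩
  rw [schejaStorch, ha.map_det_eq M hM hx hb _ _ (mk_span_range_eq_zero g) (mk_span_range_eq_zero g),
    det_bezMatrix, bez_map]

/-- The theorem for an arbitrary localization of the polynomial ring. -/
theorem schejaStorch_of_finite (M : Submonoid (MvPolynomial (Fin n) k)) [IsLocalization M L]
    (hM : M ≤ nonZeroDivisors (MvPolynomial (Fin n) k)) (f : Fin n → MvPolynomial (Fin n) k)
    {x g : Fin n → L} (hx : ∀ i, x i = algebraMap (MvPolynomial (Fin n) k) L (MvPolynomial.X i))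
    (hg : ∀ i, g i = algebraMap (MvPolynomial (Fin n) k) L (f i)) [Module.Finite k (QuotAlg g)]
    (y : Fin n → QuotAlg g) (hy : ∀ i, y i = Ideal.Quotient.mk _ (x i)) :
    (∃ a, IsDifferenceMatrix k x g a) ∧
      ∀ a, IsDifferenceMatrix k x g a →
        schejaStorch g a = bez f y ∧
        ∃ Θ : Module.Dual k (QuotAlg g) ≃ₗ[k] QuotAlg g,
          (Θ : Module.Dual k (QuotAlg g) →ₗ[k] QuotAlg g) =
            chi k (QuotAlg g) (schejaStorch g a) ∧
          (∀ Φ : LinearMap.BilinForm k (QuotAlg g),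
            IsBezoutianForm (bez f y) Φ ↔ Φ = formOf (Θ.symm 1)) ∧
          ∀ (r : ℕ) (b c : Module.Basis (Fin r) k (QuotAlg g)),
            bez f y = ∑ i, b i ⊗ₜ[k] c i →
              ∀ l : Module.Dual k (QuotAlg g), AreDual l b c ↔ l = Θ.symm 1 := by
  obtain ⟨hb, huniq⟩ := schejaStorch_eq_bez M hM f hx hg
  have hy' : y = fun i => Ideal.Quotient.mkₐ k (Ideal.span (Set.range g)) (x i) := funext hy
  refine ⟨⟨_, hb⟩, fun a ha => ⟨(huniq a ha).trans (by rw [hy']), ?_⟩⟩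
  rw [hy', ← huniq a ha]
  obtain ⟨φ, hφ⟩ := exists_isUnit_contract M hM hx ha
  refine exists_equiv_of_isUnit_contract _ (fun q => ?_) φ hφ
  obtain ⟨q, rfl⟩ := Ideal.Quotient.mk_surjective q
  set ρ := Ideal.Quotient.mkₐ k (Ideal.span (Set.range g))
  have h1 := ha.mul_det_mem (diff_mem_span M x hx q)
  obtain ⟨r, hr⟩ := (Ideal.mem_span_range_iff_exists_fun).mp h1
  have h2 := congrArg (Algebra.TensorProduct.map ρ ρ) hr
  simp only [map_sum, map_mul, map_sub, Algebra.TensorProduct.map_tmul, mk_span_range_eq_zero g, ρ,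
    TensorProduct.zero_tmul, TensorProduct.tmul_zero, sub_self, mul_zero, Finset.sum_const_zero,
    map_one] at h2
  rw [sub_mul, eq_comm, sub_eq_zero] at h2
  exact h2

end Local

/-! ### Isolated zeros and finiteness over `k` -/

section Finiteness

variable {k : Type*} [Field k] {n : ℕ}

theorem comap_mk_mem_zeroLocus (f : Fin n → MvPolynomial (Fin n) k)
    (q : PrimeSpectrum (GlobalAlg f)) :
    PrimeSpectrum.comap (Ideal.Quotient.mk (Ideal.span (Set.range f))) q ∈
      PrimeSpectrum.zeroLocus (Set.range f) := by
  rintro _ ⟨i, rfl⟩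
  change Ideal.Quotient.mk _ (f i) ∈ q.asIdeal
  rw [show Ideal.Quotient.mk (Ideal.span (Set.range f)) (f i) = 0 from
    mk_span_range_eq_zero (k := k) f i]
  exact zero_mem _

/-- An isolated zero is an isolated point of the spectrum of the global algebra. -/
theorem IsIsolatedZero.isOpen_singleton {f : Fin n → MvPolynomial (Fin n) k}
    {p : PrimeSpectrum (MvPolynomial (Fin n) k)} (hp : IsIsolatedZero f p)
    (q : PrimeSpectrum (GlobalAlg f))
    (hq : PrimeSpectrum.comap (Ideal.Quotient.mk (Ideal.span (Set.range f))) q = p) :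
    IsOpen {q} := by
  obtain ⟨U, hU, hUp⟩ := hp
  have h1 : {q} = PrimeSpectrum.comap (Ideal.Quotient.mk (Ideal.span (Set.range f))) ⁻¹' U := by
    ext r
    rw [Set.mem_singleton_iff, Set.mem_preimage]
    constructor
    · rintro rfl
      have : p ∈ U ∩ PrimeSpectrum.zeroLocus (Set.range f) := by rw [hUp]; rfl
      rw [hq]
      exact this.1
    · intro hr
      have h2 : PrimeSpectrum.comap (Ideal.Quotient.mk (Ideal.span (Set.range f))) r ∈
          U ∩ PrimeSpectrum.zeroLocus (Set.range f) := ⟨hr, comap_mk_mem_zeroLocus f r⟩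
      rw [hUp, Set.mem_singleton_iff, ← hq] at h2
      exact PrimeSpectrum.comap_injective_of_surjective _ Ideal.Quotient.mk_surjective h2
  rw [h1]
  exact hU.preimage (PrimeSpectrum.continuous_comap _)

/-- The spectrum is discrete, so the finitely generated algebra has Krull dimension at most zero and
is finite over `k`. -/
theorem HasIsolatedZeros.finite {f : Fin n → MvPolynomial (Fin n) k} (hf : HasIsolatedZeros f) :
    Module.Finite k (GlobalAlg f) := by
  have : DiscreteTopology (PrimeSpectrum (GlobalAlg f)) :=
    discreteTopology_iff_isOpen_singleton.mpr fun q =>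
      (hf _ (comap_mk_mem_zeroLocus f q)).isOpen_singleton q rfl
  rw [Module.finite_iff_krullDimLE_zero]
  exact (PrimeSpectrum.discreteTopology_iff_finite_and_krullDimLE_zero.mp this).2

/-- An isolated point of the spectrum is a point of quasi-finiteness, so the localization of the
global algebra there is finite over `k`; it surjects onto `LocalAlg f m`. -/
theorem IsIsolatedZero.finite {f : Fin n → MvPolynomial (Fin n) k}
    (m : Ideal (MvPolynomial (Fin n) k)) [hm : m.IsPrime] (hf : IsIsolatedZero f ⟨m, hm⟩) :
    Module.Finite k (LocalAlg f m) := by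
  have hmem : (⟨m, hm⟩ : PrimeSpectrum _) ∈ PrimeSpectrum.zeroLocus (Set.range f) := by
    obtain ⟨U, -, hU⟩ := hf
    have : (⟨m, hm⟩ : PrimeSpectrum _) ∈ U ∩ PrimeSpectrum.zeroLocus (Set.range f) := by
      rw [hU]; rfl
    exact this.2
  have hle : Ideal.span (Set.range f) ≤ m := Ideal.span_le.mpr hmem
  obtain ⟨q, hq⟩ : (⟨m, hm⟩ : PrimeSpectrum _) ∈ Set.range
      (PrimeSpectrum.comap (Ideal.Quotient.mk (Ideal.span (Set.range f)))) := by
    rw [range_comap_of_surjective _ _ Ideal.Quotient.mk_surjective, Ideal.mk_ker]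
    exact hle
  have hqm : ∀ y, Ideal.Quotient.mk (Ideal.span (Set.range f)) y ∈ q.asIdeal ↔ y ∈ m := fun y => by
    have := congrArg PrimeSpectrum.asIdeal hq
    rw [← show _ = m from this]
    rfl
  have h1 : Algebra.QuasiFiniteAt k q.asIdeal :=
    Algebra.QuasiFiniteAt.of_isOpen_singleton q (hf.isOpen_singleton q hq)
  have h2 : Module.Finite k (Localization.AtPrime q.asIdeal) :=
    Module.Finite.of_quasiFinite (R := k) (S := Localization.AtPrime q.asIdeal)
  let ι := IsScalarTower.toAlgHom k (MvPolynomial (Fin n) k) (Localization.AtPrime m)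
  let ρ := Ideal.Quotient.mkₐ k (Ideal.span (Set.range (atPrime m f)))
  let φ : GlobalAlg f →ₐ[k] LocalAlg f m := Ideal.Quotient.liftₐ _ (ρ.comp ι) (fun y hy => by
    have : Ideal.span (Set.range f) ≤ RingHom.ker (ρ.comp ι) := by
      rw [Ideal.span_le]
      rintro _ ⟨i, rfl⟩
      exact mk_span_range_eq_zero (k := k) (atPrime m f) i
    exact this hy)
  have hφ : ∀ y, φ (Ideal.Quotient.mk _ y) = ρ (ι y) := fun y => rfl
  have hunit : ∀ s : q.asIdeal.primeCompl, IsUnit (φ s) := by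
    rintro ⟨s, hs⟩
    obtain ⟨s, rfl⟩ := Ideal.Quotient.mk_surjective s
    rw [hφ]
    exact (IsLocalization.map_units (Localization.AtPrime m)
      (⟨s, fun h => hs ((hqm s).mpr h)⟩ : m.primeCompl)).map ρ
  let Ψ : Localization.AtPrime q.asIdeal →ₐ[k] LocalAlg f m :=
    IsLocalization.liftAlgHom (M := q.asIdeal.primeCompl) (f := φ) hunit
  refine Module.Finite.of_surjective Ψ.toLinearMap fun z => ?_
  obtain ⟨z, rfl⟩ := Ideal.Quotient.mk_surjective z
  obtain ⟨⟨y, s⟩, hys⟩ := IsLocalization.surj m.primeCompl z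
  have hs : Ideal.Quotient.mk (Ideal.span (Set.range f)) (s : MvPolynomial (Fin n) k) ∈
      q.asIdeal.primeCompl := fun h => s.2 ((hqm s).mp h)
  refine ⟨IsLocalization.mk' _ (Ideal.Quotient.mk _ y)
    (⟨_, hs⟩ : q.asIdeal.primeCompl), ?_⟩
  change Ψ _ = _
  have h3 : Ψ (IsLocalization.mk' _ (Ideal.Quotient.mk _ y) (⟨_, hs⟩ : q.asIdeal.primeCompl)) *
      φ (Ideal.Quotient.mk _ (s : MvPolynomial (Fin n) k)) = φ (Ideal.Quotient.mk _ y) := by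
    have hΨ : ∀ t, φ t = Ψ (algebraMap _ _ t) := fun t =>
      (IsLocalization.lift_eq (M := q.asIdeal.primeCompl) (g := φ.toRingHom) hunit t).symm
    rw [hΨ, hΨ, ← map_mul, IsLocalization.mk'_spec_mk]
  refine (hunit ⟨_, hs⟩).mul_right_cancel (h3.trans ?_)
  rw [hφ, hφ]
  change ρ (algebraMap _ _ y) = ρ z * ρ (algebraMap _ _ (s : MvPolynomial (Fin n) k))
  rw [← map_mul, hys]

end Finiteness

end BezSS

open BezSS in
theorem lemma4p3 {k : Type*} [Field k] {n : ℕ} (f : Fin n → MvPolynomial (Fin n) k) :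
    -- the global case
    (HasIsolatedZeros f →
      (∃ a, IsDifferenceMatrix k MvPolynomial.X f a) ∧
      ∀ a, IsDifferenceMatrix k MvPolynomial.X f a →
        schejaStorch f a = bez f (xGlobal f) ∧
        ∃ Θ : Module.Dual k (GlobalAlg f) ≃ₗ[k] GlobalAlg f,
          (Θ : Module.Dual k (GlobalAlg f) →ₗ[k] GlobalAlg f) =
            chi k (GlobalAlg f) (schejaStorch f a) ∧
          (∀ Φ : LinearMap.BilinForm k (GlobalAlg f),
            IsBezoutianForm (bez f (xGlobal f)) Φ ↔ Φ = formOf (Θ.symm 1)) ∧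
          ∀ (r : ℕ) (b c : Module.Basis (Fin r) k (GlobalAlg f)),
            bez f (xGlobal f) = ∑ i, b i ⊗ₜ[k] c i →
              ∀ l : Module.Dual k (GlobalAlg f), AreDual l b c ↔ l = Θ.symm 1) ∧
    -- the local case
    (∀ (m : Ideal (MvPolynomial (Fin n) k)) [hm : m.IsMaximal],
      IsIsolatedZero f ⟨m, hm.isPrime⟩ →
      (∃ a, IsDifferenceMatrix k (atPrime m MvPolynomial.X) (atPrime m f) a) ∧
      ∀ a, IsDifferenceMatrix k (atPrime m MvPolynomial.X) (atPrime m f) a →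
        schejaStorch (atPrime m f) a = bez f (xLocal f m) ∧
        ∃ Θ : Module.Dual k (LocalAlg f m) ≃ₗ[k] LocalAlg f m,
          (Θ : Module.Dual k (LocalAlg f m) →ₗ[k] LocalAlg f m) =
            chi k (LocalAlg f m) (schejaStorch (atPrime m f) a) ∧
          (∀ Φ : LinearMap.BilinForm k (LocalAlg f m),
            IsBezoutianForm (bez f (xLocal f m)) Φ ↔ Φ = formOf (Θ.symm 1)) ∧
          ∀ (r : ℕ) (b c : Module.Basis (Fin r) k (LocalAlg f m)),
            bez f (xLocal f m) = ∑ i, b i ⊗ₜ[k] c i →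
              ∀ l : Module.Dual k (LocalAlg f m), AreDual l b c ↔ l = Θ.symm 1) := by
  refine ⟨fun hf => ?_, fun m hm hf => ?_⟩
  · have := hf.finite
    -- The polynomial ring is its own localization at the trivial submonoid, which makes the global
    -- case an instance of the general statement.
    have : IsLocalization (⊥ : Submonoid (MvPolynomial (Fin n) k)) (MvPolynomial (Fin n) k) :=
      IsLocalization.self bot_le
    exact schejaStorch_of_finite ⊥ bot_le f (fun _ => rfl) (fun _ => rfl) (xGlobal f) fun _ => rfl
  · have := hf.finite m
    exact schejaStorch_of_finite m.primeCompl m.primeCompl_le_nonZeroDivisors f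
      (x := atPrime m MvPolynomial.X) (g := atPrime m f) (fun _ => rfl) (fun _ => rfl) (xLocal f m) fun _ => rfl
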